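/- Throughout, $\tilde W(x)=-\log|x|$ on $\mathbb R$. Consider the following finite signed measures on $\mathbb R$ (an absolutely continuous part plus point masses): * Type I: $\mu_{\mathrm I}=-1+\dfrac{\sqrt{x^2-\pi^{-2}}}{|x|}\chi_{\{|x|\ge \pi^{-1}\}}+\delta_0$. * Type II, for $R>1$: $\mu_{\mathrm{II},R}=-1+\dfrac{\sqrt{(x^2-R^2)x^2}}{|x^2-1|}\chi_{\{|x|\ge R\}}+m(\delta_1+\delta_{-1})$ with $m=\dfrac{\pi\sqrt{R^2-1}}{2}$. * Type III, for $0<L<1<R$: $\mu_{\mathrm{III},L,R}=-1+\dfrac{\sqrt{(x^2-R^2)(x^2-L^2)}}{|x^2-1|}\chi_{\{|x|\le L\}\cup\{|x|\ge R\}}+m(\delta_1+\delta_{-1})$ with $m=\dfrac{\pi\sqrt{(R^2-1)(1-L^2)}}{2}$. Let $R_c\approx 1.8102$ be the unique root in $(1,\infty)$ of $\sqrt{R^2-1}\,\ln\big(R+\sqrt{R^2-1}\big)-R=0$, and for $1<R<R_c$ let $L(R)\in(0,1)$ be the number $L$ satisfying $\mathrm{p.v.}\!\int_L^R \dfrac{\pi\sqrt{-(x^2-R^2)(x^2-L^2)}}{x^2-1}\,dx=0$.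 For $\lambda>0$ let $\mu(\tfrac{\cdot}{\lambda})$ denote the dilation of $\mu$, with the convention $\delta_a(\tfrac{\cdot}{\lambda})=\lambda\,\delta_{\lambda a}$. A signed measure on $\mathbb R$ is called admissible if it equals, for some $\lambda>0$, either $\mu_{\mathrm I}(\tfrac{\cdot}{\lambda})$ (Type I), or $\mu_{\mathrm{II},R}(\tfrac{\cdot}{\lambda})$ with $R\ge R_c$ (Type II), or $\mu_{\mathrm{III},L(R),R}(\tfrac{\cdot}{\lambda})$ with $1<R<R_c$ (Type III). The type and the number $\lambda$ are determined by the measure. For admissible $\mu$ put $$\tilde{\mathcal H}[\mu]=\int_{\mathbb R}(\tilde W*\mu)(x)\,dx,\qquad \tilde{\mathcal D}[\mu]=\begin{cases}\lambda & \text{if }\mu\text{ is of Type I},\\ \mu([-\lambda,\lambda]) & \text{if }\mu\text{ is of Type II or III.}\end{cases}$$ Theorem. Let $\mu$ be an admissible signed measure on $\mathbb R$. Then the integral defining $(\tilde W*\mu)(x)$ converges absolutely for almost every $x$, the function $\tilde W*\mu$ is integrable on $\mathbb R$, $\tilde{\mathcal D}[\mu]>0$, and $$\tilde{\mathcal G}[\mu]:=\frac{\tilde{\mathcal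 H}[\mu]}{\tilde{\mathcal D}[\mu]^2}\ \ge\ \frac12 .$$ Equality holds if and only if $\mu$ is of Type I. -/

import Mathlib

open MeasureTheory Filter Topology Set

noncomputable section

namespace LogPotential

/-! ### Signed measures on the line and their logarithmic potential -/

/-- The dilation `μ(·/lam)` of a signed measure `μ(x) dx`: the push-forward of `μ` under
`x ↦ lam * x`, multiplied by `lam`.  For a density `f` it is the density `x ↦ f (x / lam)`, and it
sends `δ_a` to `lam δ_{lam a}`. -/
def dilate (lam : ℝ) (μ : SignedMeasure ℝ) : SignedMeasure ℝ :=
  lam • μ.map (fun x => lam * x)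

/-- The integrand of the logarithmic potential at `x`. -/
def logKernel (x y : ℝ) : ℝ := -Real.log |x - y|

/-- The logarithmic potential `(W * μ)(x) = ∫ -log |x - y| dμ(y)` of a signed measure. -/
def logPotential (μ : SignedMeasure ℝ) (x : ℝ) : ℝ := ∫ᵛ y, logKernel x y ∂•μ

/-- The functional `H[μ] = ∫ (W * μ)(x) dx`. -/
def energyH (μ : SignedMeasure ℝ) : ℝ := ∫ x, logPotential μ x

/-! ### The stationary distributions of Types I, II, III -/

/-- The density of the absolutely continuous part of the Type I distribution. -/
def densityI (x : ℝ) : ℝ :=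
  -1 + {y : ℝ | Real.pi⁻¹ ≤ |y|}.indicator (fun y => √(y ^ 2 - (Real.pi⁻¹) ^ 2) / |y|) x

/-- The Type I distribution: `densityI` plus a unit Dirac mass at the origin. -/
def muI : SignedMeasure ℝ :=
  volume.withDensityᵥ densityI + VectorMeasure.dirac 0 (1 : ℝ)

/-- The density of the absolutely continuous part of the Type II distribution. -/
def densityII (R x : ℝ) : ℝ :=
  -1 + {y : ℝ | R ≤ |y|}.indicator
    (fun y => √((y ^ 2 - R ^ 2) * y ^ 2) / |y ^ 2 - 1|) x

/-- The mass of each of the two atoms of the Type II distribution. -/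
def massII (R : ℝ) : ℝ := Real.pi * √(R ^ 2 - 1) / 2

/-- The Type II distribution with parameter `R`. -/
def muII (R : ℝ) : SignedMeasure ℝ :=
  volume.withDensityᵥ (densityII R) +
    massII R • (VectorMeasure.dirac 1 (1 : ℝ) + VectorMeasure.dirac (-1) (1 : ℝ))

/-- The density of the absolutely continuous part of the Type III distribution. -/
def densityIII (L R x : ℝ) : ℝ :=
  -1 + {y : ℝ | |y| ≤ L ∨ R ≤ |y|}.indicator
    (fun y => √((y ^ 2 - R ^ 2) * (y ^ 2 - L ^ 2)) / |y ^ 2 - 1|) x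

/-- The mass of each of the two atoms of the Type III distribution. -/
def massIII (L R : ℝ) : ℝ := Real.pi * √((R ^ 2 - 1) * (1 - L ^ 2)) / 2

/-- The Type III distribution with parameters `L` and `R`. -/
def muIII (L R : ℝ) : SignedMeasure ℝ :=
  volume.withDensityᵥ (densityIII L R) +
    massIII L R • (VectorMeasure.dirac 1 (1 : ℝ) + VectorMeasure.dirac (-1) (1 : ℝ))

/-! ### The critical radius -/

theorem hasDerivAt_critFun {R : ℝ} (hR : 1 < R) :
    HasDerivAt (fun R : ℝ => √(R ^ 2 - 1) * Real.log (R + √(R ^ 2 - 1)) - R)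
      (R / √(R ^ 2 - 1) * Real.log (R + √(R ^ 2 - 1))) R := by
  have h0 : 0 < R ^ 2 - 1 := by nlinarith
  have hs : 0 < √(R ^ 2 - 1) := Real.sqrt_pos.mpr h0
  have h1 : HasDerivAt (fun R : ℝ => √(R ^ 2 - 1)) (R / √(R ^ 2 - 1)) R := by
    have h2 : HasDerivAt (fun R : ℝ => R ^ 2 - 1) (2 * R) R := by
      simpa using (hasDerivAt_pow 2 R).sub_const 1
    convert h2.sqrt h0.ne' using 1
    field_simp
  have hp : R + √(R ^ 2 - 1) ≠ 0 := by positivity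
  have h3 : HasDerivAt (fun R : ℝ => Real.log (R + √(R ^ 2 - 1)))
      ((1 + R / √(R ^ 2 - 1)) / (R + √(R ^ 2 - 1))) R :=
    ((hasDerivAt_id' R).fun_add h1).log hp
  have h4 := (h1.fun_mul h3).fun_sub (hasDerivAt_id' R)
  refine h4.congr_deriv ?_
  field_simp
  ring

theorem existsUnique_critical_radius :
    ∃! R : ℝ, 1 < R ∧ √(R ^ 2 - 1) * Real.log (R + √(R ^ 2 - 1)) - R = 0 := by
  set f : ℝ → ℝ := fun R => √(R ^ 2 - 1) * Real.log (R + √(R ^ 2 - 1)) - R with hf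
  have hcont : ContinuousOn f (Ici 1) := by
    refine ContinuousOn.sub (ContinuousOn.mul (by fun_prop) (ContinuousOn.log (by fun_prop) ?_))
      continuousOn_id
    intro x hx
    have : (1 : ℝ) ≤ x := hx
    positivity
  have hmono : StrictMonoOn f (Ici 1) := by
    refine strictMonoOn_of_deriv_pos (convex_Ici 1) hcont ?_
    intro x hx
    rw [interior_Ici] at hx
    have hx1 : (1 : ℝ) < x := hx
    have hs : 0 < √(x ^ 2 - 1) := Real.sqrt_pos.mpr (by nlinarith)
    rw [(hasDerivAt_critFun hx1).deriv]
    have : 0 < Real.log (x + √(x ^ 2 - 1)) := Real.log_pos (by linarith)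
    positivity
  have hf1 : f 1 < 0 := by simp [hf]
  have hf2 : 0 < f 2 := by
    have e : ((2 : ℝ) ^ 2 - 1) = 3 := by norm_num
    simp only [hf, e]
    have h3 : (1.73 : ℝ) < √3 := by
      rw [Real.lt_sqrt (by norm_num)]; norm_num
    have hl : (1.16 : ℝ) < Real.log (2 + √3) := by
      rw [Real.lt_log_iff_exp_lt (by positivity)]
      have a1 := Real.exp_one_lt_d9
      have a2 : Real.exp (0.16 : ℝ) ≤ 1.2 := by
        have := Real.exp_bound_div_one_sub_of_interval (x := 0.16) (by norm_num) (by norm_num)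
        refine this.trans (by norm_num)
      have : Real.exp (1.16 : ℝ) = Real.exp 1 * Real.exp 0.16 := by
        rw [← Real.exp_add]; norm_num
      rw [this]
      nlinarith [Real.exp_pos 1, Real.exp_pos 0.16]
    nlinarith
  obtain ⟨R, hR, hR0⟩ : (0 : ℝ) ∈ f '' Icc 1 2 :=
    intermediate_value_Icc (by norm_num) (hcont.mono Icc_subset_Ici_self) ⟨hf1.le, hf2.le⟩
  have hR1 : 1 < R := by
    rcases hR.1.lt_or_eq with h | h
    · exact h
    · rw [← h] at hR0; exact absurd hR0 hf1.ne
  refine ⟨R, ⟨hR1, hR0⟩, ?_⟩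
  rintro S ⟨hS1, hS0⟩
  exact hmono.injOn (show (1 : ℝ) ≤ S from hS1.le) (show (1 : ℝ) ≤ R from hR1.le)
    (hS0.trans hR0.symm)

/-- The critical radius: the unique root in `(1, ∞)` of
`√(R² - 1) log (R + √(R² - 1)) - R = 0` (about `1.8102`). -/
def Rc : ℝ := existsUnique_critical_radius.choose

/-! ### Principal values and the parameter `L(R)` -/

/-- The Cauchy principal value of `∫ f` over `[a, b]`, with a singularity at `c ∈ (a, b)`,
exists and equals `v`. -/
def HasPrincipalValue (f : ℝ → ℝ) (a c b v : ℝ) : Prop :=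
  Tendsto (fun ε : ℝ => (∫ x in a..(c - ε), f x) + ∫ x in (c + ε)..b, f x) (𝓝[>] 0) (𝓝 v)

/-- `L = L(R)`: the number `L ∈ (0, 1)` for which the principal value `Φ(L, R)` of
`∫_L^R π √(-(x² - R²)(x² - L²)) / (x² - 1) dx` vanishes. -/
def IsLOf (R L : ℝ) : Prop :=
  0 < L ∧ L < 1 ∧ HasPrincipalValue
    (fun x => Real.pi * √(-((x ^ 2 - R ^ 2) * (x ^ 2 - L ^ 2))) / (x ^ 2 - 1)) L 1 R 0

/-! ### Admissible distributions -/

/-- `μ` is of Type I with scaling factor `lam`. -/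
def IsTypeIWith (lam : ℝ) (μ : SignedMeasure ℝ) : Prop :=
  0 < lam ∧ μ = dilate lam muI

/-- `μ` is admissible of Type II with scaling factor `lam`. -/
def IsTypeIIWith (lam : ℝ) (μ : SignedMeasure ℝ) : Prop :=
  0 < lam ∧ ∃ R : ℝ, Rc ≤ R ∧ μ = dilate lam (muII R)

/-- `μ` is admissible of Type III with scaling factor `lam`. -/
def IsTypeIIIWith (lam : ℝ) (μ : SignedMeasure ℝ) : Prop :=
  0 < lam ∧ ∃ R L : ℝ, 1 < R ∧ R < Rc ∧ IsLOf R L ∧ μ = dilate lam (muIII L R)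

/-- `μ` is admissible with scaling factor `lam`. -/
def HasScalingFactor (μ : SignedMeasure ℝ) (lam : ℝ) : Prop :=
  IsTypeIWith lam μ ∨ IsTypeIIWith lam μ ∨ IsTypeIIIWith lam μ

/-- `μ` is of Type I, i.e. a dilation of `muI`. -/
def IsTypeI (μ : SignedMeasure ℝ) : Prop := ∃ lam : ℝ, IsTypeIWith lam μ

/-- Admissible signed measures. -/
def Admissible (μ : SignedMeasure ℝ) : Prop := ∃ lam : ℝ, HasScalingFactor μ lam

open Classical in
/-- The scaling factor of an admissible signed measure (and `0` otherwise); it is unique by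
`HasScalingFactor.unique` below. -/
def scalingFactor (μ : SignedMeasure ℝ) : ℝ :=
  if h : Admissible μ then h.choose else 0

open Classical in
/-- The functional `D[μ]`: the scaling factor `lam` for a Type I distribution, and the total mass
`μ([-lam, lam])` (atoms at `±lam` included) for an admissible one of Type II or III. -/
def massD (μ : SignedMeasure ℝ) : ℝ :=
  if IsTypeI μ then scalingFactor μ
  else μ (Icc (-scalingFactor μ) (scalingFactor μ))

/-- The goal functional `G[μ] = H[μ] / D[μ]²`. -/
def goalG (μ : SignedMeasure ℝ) : ℝ := energyH μ / massD μ ^ 2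

/-! ### The scaling factor is well defined -/

theorem withDensity_singleton (f : ℝ → ℝ) (x : ℝ) :
    (volume.withDensityᵥ f : SignedMeasure ℝ) {x} = 0 := by
  by_cases hf : Integrable f volume
  · rw [withDensityᵥ_apply hf (measurableSet_singleton x)]
    simp
  · simp [Measure.withDensityᵥ, hf]

theorem dilate_singleton {lam : ℝ} (hl : 0 < lam) (μ : SignedMeasure ℝ) (x : ℝ) :
    dilate lam μ {x} = lam * μ {x / lam} := by
  have h : (fun y : ℝ => lam * y) ⁻¹' {x} = {x / lam} := by
    ext y
    simp only [mem_preimage, mem_singleton_iff]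
    rw [eq_div_iff hl.ne', mul_comm]
  have hm : Measurable fun y : ℝ => lam * y := measurable_const_mul lam
  simp [dilate, VectorMeasure.map_apply _ hm (measurableSet_singleton x), h]

theorem typeI_singleton {lam : ℝ} {μ : SignedMeasure ℝ} (h : IsTypeIWith lam μ) :
    μ {0} = lam := by
  obtain ⟨hl, rfl⟩ := h
  rw [dilate_singleton hl, muI, _root_.add_apply, withDensity_singleton, zero_div,
    VectorMeasure.dirac_apply_of_mem (measurableSet_singleton _) (mem_singleton _)]
  simp

theorem twoAtoms_singleton (f : ℝ → ℝ) {m : ℝ} (x : ℝ) :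
    (volume.withDensityᵥ f +
      m • (VectorMeasure.dirac 1 (1 : ℝ) + VectorMeasure.dirac (-1) (1 : ℝ)) :
        SignedMeasure ℝ) {x} = if x = 1 ∨ x = -1 then m else 0 := by
  rw [_root_.add_apply, withDensity_singleton, _root_.smul_apply,
    _root_.add_apply]
  by_cases h1 : x = 1
  · subst h1
    rw [VectorMeasure.dirac_apply_of_mem (measurableSet_singleton _) (mem_singleton _),
      VectorMeasure.dirac_apply_of_notMem (by norm_num)]
    simp
  · by_cases h2 : x = -1
    · subst h2
      rw [VectorMeasure.dirac_apply_of_mem (x := (-1 : ℝ)) (measurableSet_singleton _)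
          (mem_singleton _), VectorMeasure.dirac_apply_of_notMem (by norm_num)]
      simp
    · rw [VectorMeasure.dirac_apply_of_notMem (by simpa using Ne.symm h1),
        VectorMeasure.dirac_apply_of_notMem (by simpa using Ne.symm h2)]
      simp [h1, h2]

theorem one_lt_Rc : 1 < Rc := existsUnique_critical_radius.choose_spec.1.1

theorem typeII_or_III_singleton {lam : ℝ} {μ : SignedMeasure ℝ}
    (h : IsTypeIIWith lam μ ∨ IsTypeIIIWith lam μ) :
    0 < lam ∧ ∃ m : ℝ, 0 < m ∧ ∀ x, μ {x} = if x = lam ∨ x = -lam then m else 0 := by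
  have key : 0 < lam ∧ ∃ (f : ℝ → ℝ) (m : ℝ), 0 < m ∧ μ = dilate lam (volume.withDensityᵥ f +
      m • (VectorMeasure.dirac 1 (1 : ℝ) + VectorMeasure.dirac (-1) (1 : ℝ))) := by
    rcases h with ⟨hl, R, hR, rfl⟩ | ⟨hl, R, L, hR, -, ⟨hL0, hL1, -⟩, rfl⟩
    · refine ⟨hl, densityII R, massII R, ?_, rfl⟩
      have h1 : 1 < R := one_lt_Rc.trans_le hR
      have : 0 < √(R ^ 2 - 1) := Real.sqrt_pos.mpr (by nlinarith)
      unfold massII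
      positivity
    · refine ⟨hl, densityIII L R, massIII L R, ?_, rfl⟩
      have : 0 < √((R ^ 2 - 1) * (1 - L ^ 2)) :=
        Real.sqrt_pos.mpr (mul_pos (by nlinarith) (by nlinarith))
      unfold massIII
      positivity
  obtain ⟨hl, f, m, hm, rfl⟩ := key
  refine ⟨hl, lam * m, mul_pos hl hm, fun x => ?_⟩
  rw [dilate_singleton hl, twoAtoms_singleton]
  have e1 : x / lam = 1 ↔ x = lam := by rw [div_eq_one_iff_eq hl.ne']
  have e2 : x / lam = -1 ↔ x = -lam := by
    rw [div_eq_iff hl.ne']; simp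
  simp only [e1, e2, mul_ite, mul_zero]

theorem HasScalingFactor.unique {μ : SignedMeasure ℝ} {a b : ℝ}
    (ha : HasScalingFactor μ a) (hb : HasScalingFactor μ b) : a = b := by
  rcases ha with ha | ha <;> rcases hb with hb | hb
  · exact (typeI_singleton ha).symm.trans (typeI_singleton hb)
  · obtain ⟨hb0, m, hm, hb⟩ := typeII_or_III_singleton hb
    have h0 := hb 0
    rw [typeI_singleton ha, if_neg (by
      rintro (h | h) <;> linarith)] at h0
    exact absurd h0 ha.1.ne'
  · obtain ⟨ha0, m, hm, ha⟩ := typeII_or_III_singleton ha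
    have h0 := ha 0
    rw [typeI_singleton hb, if_neg (by
      rintro (h | h) <;> linarith)] at h0
    exact absurd h0 hb.1.ne'
  · obtain ⟨ha0, m, hm, ha⟩ := typeII_or_III_singleton ha
    obtain ⟨hb0, n, hn, hb⟩ := typeII_or_III_singleton hb
    have h := ha a
    rw [hb a, if_pos (Or.inl rfl)] at h
    by_contra hab
    rw [if_neg (by rintro (h' | h') <;> [exact hab h'; linarith])] at h
    linarith

theorem scalingFactor_eq {μ : SignedMeasure ℝ} {lam : ℝ} (h : HasScalingFactor μ lam) :
    scalingFactor μ = lam := by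
  have hA : Admissible μ := ⟨lam, h⟩
  rw [scalingFactor, dif_pos hA]
  exact hA.choose_spec.unique h

end LogPotential

end

namespace LogPotential

/-! Every admissible measure is a dilate, by some `λ`, of an even density `h` neutralised by two
atoms of mass `m` at `±q`, where `h(y) = -κ/(1 + y²) + O(y⁻⁴)`. Type I fits with two half atoms at
`q = 0`, and Type II is Type III with `L = 0`.

For such a measure the energy depends only on the tail coefficient: it equals `λ²κπ²`
(`NeutralDensity.integral_pot`, `NeutralDensity.energyH_dilate`). Indeed `h + κ/(1 + y²)` has a
finite first moment and, by evenness, acts through the kernel `log|1 - y²/x²|`, whose integral in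
`x` vanishes for every `y`; so do the atoms, because neutrality cancels the `log|x|` terms. Only the
potential of the Cauchy density is left, and it is explicit. Neutrality is a contour integral for
Types II and III (`integral_densityIII`) and an explicit primitive for Type I.

For Type I, `κ = 1/(2π²)` and the quotient is exactly `1/2`. Otherwise `κ = (R² + L²)/2 - 1`, and
with `D` the mass of the undilated measure on `[-1, 1]` the claim becomes `D > 0` and `D² < π²(R² +
L² - 2)`. For `L = 0`, `D = π√(R² - 1) - 2` and the bound `R > 3/2` suffices. For Type III,
subtracting an explicit principal value turns the equation for `L(R)` into a nonsingular identity
(`IsLOf.integral_eq`), which yields `R² + L² > 2`, `RL < 1` and the quantitative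
`IsLOf.quadratic_le`. In terms of `e = √(R² + L² - 2)` and `p = √((R² - 1)(1 - L²))`, the bound on
`D` then reduces to `quadratic_pos`. -/

/-! ### Integration against a density with two atoms, and dilation of its potential -/

theorem integrable_withDensityᵥ {h f : ℝ → ℝ} (hh : Integrable h)
    (hfm : AEStronglyMeasurable f) (hf : Integrable (fun x => f x * h x)) :
    (volume.withDensityᵥ h : SignedMeasure ℝ).Integrable f := by
  rw [VectorMeasure.Integrable, Measure.variation_withDensityᵥ hh,
    integrable_withDensity_iff_integrable_smul₀' hh.aestronglyMeasurable.enorm (by simp)]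
  refine hf.mono (hh.aestronglyMeasurable.enorm.ennreal_toReal.aestronglyMeasurable.smul hfm) ?_
  · filter_upwards with x
    simp [mul_comm]

theorem integral_withDensityᵥ {h f : ℝ → ℝ} (hh : Integrable h)
    (hfm : AEStronglyMeasurable f) (hf : Integrable (fun x => f x * h x)) :
    ∫ᵛ x, f x ∂•(volume.withDensityᵥ h : SignedMeasure ℝ) = ∫ x, f x * h x := by
  have e : (ContinuousLinearMap.lsmul ℝ ℝ : ℝ →L[ℝ] ℝ →L[ℝ] ℝ)
      = (ContinuousLinearMap.lsmul ℝ ℝ : ℝ →L[ℝ] ℝ →L[ℝ] ℝ).flip := by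
    ext; simp
  have i1 := isFiniteMeasure_withDensity_ofReal hh.2
  have i2 := isFiniteMeasure_withDensity_ofReal hh.neg.2
  have m1 : AEMeasurable (fun x => ENNReal.ofReal (h x)) := hh.aemeasurable.ennreal_ofReal
  have m2 : AEMeasurable (fun x => ENNReal.ofReal (-h x)) := hh.neg.aemeasurable.ennreal_ofReal
  have key : ∀ k : ℝ → ℝ, AEMeasurable k → (∀ x, |k x| ≤ |h x|) →
      Integrable (fun x => k x • f x) := fun k hk hkh =>
    hf.mono (hk.aestronglyMeasurable.smul hfm) (Eventually.of_forall fun x => by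
      simp only [smul_eq_mul, norm_mul, Real.norm_eq_abs]
      rw [mul_comm]; exact mul_le_mul_of_nonneg_left (hkh x) (abs_nonneg _))
  have j1 : Integrable f (volume.withDensity fun x => ENNReal.ofReal (h x)) := by
    rw [integrable_withDensity_iff_integrable_smul₀' m1 (by simp)]
    exact key _ m1.ennreal_toReal fun x => by
      rw [ENNReal.toReal_ofReal']; exact abs_max_le_max_abs_abs.trans (by simp)
  have j2 : Integrable f (volume.withDensity fun x => ENNReal.ofReal (-h x)) := by
    rw [integrable_withDensity_iff_integrable_smul₀' m2 (by simp)]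
    exact key _ m2.ennreal_toReal fun x => by
      rw [ENNReal.toReal_ofReal']; exact abs_max_le_max_abs_abs.trans (by simp)
  rw [withDensityᵥ_eq_withDensity_pos_part_sub_withDensity_neg_part hh, e,
    VectorMeasure.integral_sub_vectorMeasure, VectorMeasure.integral_toSignedMeasure,
    VectorMeasure.integral_toSignedMeasure,
    integral_withDensity_eq_integral_toReal_smul₀ m1 (by simp),
    integral_withDensity_eq_integral_toReal_smul₀ m2 (by simp), ← integral_sub]
  · congr 1; ext x
    simp only [ENNReal.toReal_ofReal', smul_eq_mul]
    rw [← sub_mul, max_zero_sub_eq_self, mul_comm]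
  · exact (integrable_withDensity_iff_integrable_smul₀' m1 (by simp)).1 j1
  · exact (integrable_withDensity_iff_integrable_smul₀' m2 (by simp)).1 j2
  · simpa [VectorMeasure.Integrable] using j1
  · simpa [VectorMeasure.Integrable] using j2

/-- The signed measure with density `h` and two atoms of mass `m` at `q` and `-q`. -/
noncomputable def twoAtomMeasure (h : ℝ → ℝ) (m q : ℝ) : SignedMeasure ℝ :=
  volume.withDensityᵥ h + m • (VectorMeasure.dirac q (1 : ℝ) + VectorMeasure.dirac (-q) (1 : ℝ))

theorem integrable_dirac (f : ℝ → ℝ) (q : ℝ) :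
    (VectorMeasure.dirac q (1 : ℝ) : SignedMeasure ℝ).Integrable f := by
  rw [VectorMeasure.Integrable, VectorMeasure.variation_dirac]
  have : Integrable f (Measure.dirac q) := MeasureTheory.integrable_dirac (by simp)
  simpa using this

theorem integrable_twoAtomMeasure {h f : ℝ → ℝ} (m q : ℝ) (hh : Integrable h)
    (hfm : AEStronglyMeasurable f) (hf : Integrable (fun x => f x * h x)) :
    (twoAtomMeasure h m q).Integrable f :=
  (integrable_withDensityᵥ hh hfm hf).add_vectorMeasure
    (((integrable_dirac f q).add_vectorMeasure (integrable_dirac f (-q))).smul_vectorMeasure m)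

theorem integral_twoAtomMeasure {h f : ℝ → ℝ} (m q : ℝ) (hh : Integrable h)
    (hfm : AEStronglyMeasurable f) (hf : Integrable (fun x => f x * h x)) :
    ∫ᵛ x, f x ∂•(twoAtomMeasure h m q) = (∫ x, f x * h x) + m * (f q + f (-q)) := by
  rw [twoAtomMeasure, VectorMeasure.integral_add_vectorMeasure (integrable_withDensityᵥ hh hfm hf)
    (((integrable_dirac f q).add_vectorMeasure (integrable_dirac f (-q))).smul_vectorMeasure m),
    VectorMeasure.integral_smul_vectorMeasure, VectorMeasure.integral_add_vectorMeasure
    (integrable_dirac f q) (integrable_dirac f (-q)), integral_withDensityᵥ hh hfm hf]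
  simp

theorem measurable_logKernel (x : ℝ) : Measurable (logKernel x) := by
  unfold logKernel; fun_prop

/-- Scaling of the logarithmic potential of a neutral signed measure. -/
theorem logPotential_dilate {h : ℝ → ℝ} {m q lam : ℝ} (hl : 0 < lam) (hh : Integrable h)
    (hneutral : ∫ x, h x = -2 * m) (hlog : ∀ x, Integrable (fun y => logKernel x y * h y))
    (x : ℝ) : 
    (dilate lam (twoAtomMeasure h m q)).Integrable (logKernel x) ∧ 
    logPotential (dilate lam (twoAtomMeasure h m q)) x
      = lam * ((∫ y, Real.log |x / lam - y| * -h y) - 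
        m * (Real.log |x - lam * q| + Real.log |x + lam * q|-2*Real.log lam)) := by
  have hemb : MeasurableEmbedding (fun x : ℝ => lam * x) :=
    (MeasurableEquiv.mulLeft₀ lam hl.ne').measurableEmbedding
  -- The point `y = x / lam` has to be excluded: there `Real.log 0 = 0` and the product rule for the
  -- logarithm is not available.
  have hae : (fun y => logKernel x (lam * y) * h y) =ᵐ[volume] 
      fun y => logKernel (x / lam) y * h y - Real.log lam * h y := by
    have : ∀ᵐ y : ℝ, y ≠ x / lam := by simp [ae_iff]
    filter_upwards [this] with y hy
    have h1 : x - lam * y = lam * (x / lam - y) := by field_simp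
    have h2 : |x / lam - y| ≠ 0 := abs_ne_zero.2 (sub_ne_zero.2 hy.symm)
    simp only [logKernel]
    rw [h1, abs_mul, abs_of_pos hl, Real.log_mul hl.ne' h2]
    ring
  have hint : Integrable fun y => logKernel x (lam * y) * h y :=
    ((hlog (x / lam)).sub (hh.const_mul _)).congr hae.symm
  have hmeas : Measurable fun y => logKernel x (lam * y) :=
    (measurable_logKernel x).comp (measurable_const_mul lam)
  constructor
  · refine VectorMeasure.Integrable.smul_vectorMeasure ?_ lam
    rw [hemb.integrable_map_vectorMeasure]
    exact integrable_twoAtomMeasure m q hh hmeas.aestronglyMeasurable hint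
  · rw [logPotential, dilate, VectorMeasure.integral_smul_vectorMeasure,
      hemb.integral_map_vectorMeasure, 
      integral_twoAtomMeasure m q hh hmeas.aestronglyMeasurable hint, integral_congr_ae hae,
      integral_sub (hlog _) (hh.const_mul _), integral_const_mul, hneutral]
    simp only [logKernel, smul_eq_mul, neg_mul, mul_neg]
    ring_nf

/-! ### The logarithmic potential of the Cauchy density -/

/-- `Real.log` ignores the sign of its argument, so the period is `π` rather than `2π`. -/
theorem log_sin_periodic : Function.Periodic (fun u => Real.log (Real.sin u)) Real.pi := fun u => by
  simp [Real.sin_add_pi]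

theorem integral_log_sin_period (t : ℝ) :
    ∫ u in t..(t + Real.pi), Real.log (Real.sin u) = -Real.log 2 * Real.pi := by
  rw [log_sin_periodic.intervalIntegral_add_eq t 0, zero_add, integral_log_sin_zero_pi]

/-- This is the Cauchy potential after the substitution `y = tan φ`. With `x = tan ψ` one has `x -
tan φ = sin(ψ - φ) / (cos ψ cos φ)`, so the logarithm splits; the integrals of `log sin` and `log
cos` run over a full period and cancel, leaving `-π log cos ψ`. -/
theorem cauchy_log_aux (x : ℝ) :
    IntegrableOn (fun φ => Real.log |x - Real.tan φ|) (Ioo (-(Real.pi / 2)) (Real.pi / 2)) ∧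
    ∫ φ in Ioo (-(Real.pi / 2)) (Real.pi / 2), Real.log |x - Real.tan φ|
      = Real.pi / 2 * Real.log (1 + x ^ 2) := by
  have hpi := Real.pi_pos
  set ψ := Real.arctan x with hψ
  have hc : 0 < Real.cos ψ := Real.cos_arctan_pos x
  have hae : (fun φ => Real.log (Real.sin (ψ - φ)) - Real.log (Real.cos ψ) -
      Real.log (Real.cos φ)) =ᵐ[volume.restrict (Ioo (-(Real.pi / 2)) (Real.pi / 2))]
      fun φ => Real.log |x - Real.tan φ| := by
    rw [EventuallyEq, ae_restrict_iff' measurableSet_Ioo]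
    have : ∀ᵐ y : ℝ, y ≠ ψ := by simp [ae_iff]
    filter_upwards [this] with φ hφ hm
    have hcφ : 0 < Real.cos φ := Real.cos_pos_of_mem_Ioo hm
    have hx : x = Real.tan ψ := (Real.tan_arctan x).symm
    have h1 : x - Real.tan φ = Real.sin (ψ - φ) / (Real.cos ψ * Real.cos φ) := by
      rw [hx, Real.tan_eq_sin_div_cos, Real.tan_eq_sin_div_cos, Real.sin_sub]
      field_simp
    have hs : Real.sin (ψ - φ) ≠ 0 := by
      intro h0
      rw [h0, zero_div, sub_eq_zero] at h1
      apply hφ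
      rw [hψ, h1, Real.arctan_tan hm.1 hm.2]
    rw [Real.log_abs, h1, Real.log_div hs (by positivity), Real.log_mul hc.ne' hcφ.ne']
    ring
  have hle : -(Real.pi / 2) ≤ Real.pi / 2 := by linarith
  have i1 : IntervalIntegrable (fun φ => Real.log (Real.sin (ψ - φ))) volume
      (-(Real.pi / 2)) (Real.pi / 2) := by
    have := (intervalIntegrable_log_sin (a := ψ - -(Real.pi / 2)) (b := ψ - Real.pi / 2)).comp_sub_left ψ
    simpa using this
  have i2 : IntervalIntegrable (fun φ => Real.log (Real.cos φ)) volume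
      (-(Real.pi / 2)) (Real.pi / 2) := intervalIntegrable_log_cos
  have i3 : IntervalIntegrable (fun _ : ℝ => Real.log (Real.cos ψ)) volume
      (-(Real.pi / 2)) (Real.pi / 2) := intervalIntegrable_const
  have e1 : ∫ φ in (-(Real.pi / 2))..(Real.pi / 2), Real.log (Real.sin (ψ - φ))
      = -Real.log 2 * Real.pi := by
    rw [intervalIntegral.integral_comp_sub_left (fun u => Real.log (Real.sin u)) ψ,
      ← integral_log_sin_period (ψ - Real.pi / 2)]
    congr 1; ring
  have e2 : ∫ φ in (-(Real.pi / 2))..(Real.pi / 2), Real.log (Real.cos φ)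
      = -Real.log 2 * Real.pi := by
    have : ∀ φ, Real.log (Real.cos φ) = Real.log (Real.sin (φ + Real.pi / 2)) := fun φ => by
      rw [Real.sin_add_pi_div_two]
    simp_rw [this]
    rw [intervalIntegral.integral_comp_add_right (fun u => Real.log (Real.sin u)),
      ← integral_log_sin_period 0]
    congr 1 <;> ring
  have hi := (i1.sub i3).sub i2
  refine ⟨?_, ?_⟩
  · refine Integrable.congr ?_ hae
    exact ((intervalIntegrable_iff_integrableOn_Ioo_of_le hle).1 hi)
  · rw [← integral_congr_ae hae, ← integral_Ioc_eq_integral_Ioo,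
      ← intervalIntegral.integral_of_le hle, intervalIntegral.integral_sub (i1.sub i3) i2,
      intervalIntegral.integral_sub i1 i3, e1, e2, intervalIntegral.integral_const]
    have hcos : Real.log (Real.cos ψ) = -(1 / 2) * Real.log (1 + x ^ 2) := by
      rw [hψ, Real.cos_arctan, Real.log_div one_ne_zero (by positivity), Real.log_sqrt (by positivity)]
      simp; ring
    rw [hcos]; simp; ring

/-- The logarithmic potential of the Cauchy distribution. -/
theorem integral_log_div_one_add_sq (x : ℝ) :
    Integrable (fun y => Real.log |x - y| * (1 + y ^ 2)⁻¹) ∧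
    ∫ y, Real.log |x - y| * (1 + y ^ 2)⁻¹ = Real.pi / 2 * Real.log (1 + x ^ 2) := by
  have hd : ∀ φ ∈ Ioo (-(Real.pi / 2)) (Real.pi / 2),
      HasDerivWithinAt Real.tan (1 / Real.cos φ ^ 2) (Ioo (-(Real.pi / 2)) (Real.pi / 2)) φ :=
    fun φ hφ => (Real.hasDerivAt_tan (Real.cos_pos_of_mem_Ioo hφ).ne').hasDerivWithinAt
  have hinj : InjOn Real.tan (Ioo (-(Real.pi / 2)) (Real.pi / 2)) := Real.injOn_tan
  have himg : Real.tan '' Ioo (-(Real.pi / 2)) (Real.pi / 2) = univ := Real.image_tan_Ioo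
  have hEq : EqOn (fun φ => |1 / Real.cos φ ^ 2| • (Real.log |x - Real.tan φ| *
      (1 + Real.tan φ ^ 2)⁻¹)) (fun φ => Real.log |x - Real.tan φ|)
      (Ioo (-(Real.pi / 2)) (Real.pi / 2)) := fun φ hφ => by
    have hc := Real.cos_pos_of_mem_Ioo hφ
    simp only [smul_eq_mul]
    rw [Real.inv_one_add_tan_sq hc.ne', abs_of_pos (by positivity)]
    field_simp
  obtain ⟨h1, h2⟩ := cauchy_log_aux x
  constructor
  · rw [← integrableOn_univ, ← himg, integrableOn_image_iff_integrableOn_abs_deriv_smul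
      measurableSet_Ioo hd hinj]
    exact h1.congr_fun hEq.symm measurableSet_Ioo
  · rw [← setIntegral_univ, ← himg, integral_image_eq_integral_abs_deriv_smul
      measurableSet_Ioo hd hinj, setIntegral_congr_fun measurableSet_Ioo hEq, h2]

/-! ### The kernel `log |1 - y²/x²|` and its vanishing integral in `x` -/

theorem integrable_of_le_inv_one_add_sq {f : ℝ → ℝ} {C T : ℝ} (hT : 0 ≤ T) (hm : Measurable f)
    (hi : IntervalIntegrable f volume (-T) T)
    (hb : ∀ x, T < |x| → |f x| ≤ C * (1 + x ^ 2)⁻¹) : Integrable f := by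
  have h1 : IntegrableOn f (Icc (-T) T) :=
    (intervalIntegrable_iff_integrableOn_Icc_of_le (by linarith)).1 hi
  have h2 : IntegrableOn f (Icc (-T) T)ᶜ := by
    refine Integrable.mono' (integrable_inv_one_add_sq.const_mul C).integrableOn
      hm.aestronglyMeasurable ?_
    filter_upwards [ae_restrict_mem measurableSet_Icc.compl] with x hx
    refine hb x ?_
    by_contra h
    exact hx (abs_le.1 (not_lt.1 h))
  have := h1.union h2
  rwa [union_compl_self, integrableOn_univ] at this

/-- The kernel `s ↦ log |1 - s⁻²|`. -/
noncomputable def logRatio (s : ℝ) : ℝ := Real.log (1 - (s ^ 2)⁻¹)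

theorem measurable_logRatio : Measurable logRatio := by unfold logRatio; fun_prop

theorem logRatio_zero : logRatio 0 = 0 := by simp [logRatio]

/-- The case `y = 0` is included, thanks to the conventions for division by zero and `Real.log`; it
is needed for the Type I atoms, which sit at the origin. -/
theorem logRatio_div {x y : ℝ} (hx : x ≠ 0) (h1 : x ≠ y) (h2 : x ≠ -y) :
    logRatio (x / y) = Real.log |x - y| + Real.log |x + y| - 2 * Real.log |x| := by
  rcases eq_or_ne y 0 with rfl | hy
  · simp [logRatio]; ring
  · have e1 : x - y ≠ 0 := sub_ne_zero.2 h1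
    have e2 : x + y ≠ 0 := fun h => h2 (by linarith)
    have : 1 - ((x / y) ^ 2)⁻¹ = (x - y) * (x + y) / x ^ 2 := by field_simp; ring
    rw [logRatio, this, Real.log_div (mul_ne_zero e1 e2) (by positivity), Real.log_mul e1 e2,
      Real.log_pow, Real.log_abs, Real.log_abs, Real.log_abs]
    push_cast; ring

theorem ae_ne_real (a : ℝ) : ∀ᵐ x : ℝ, x ≠ a := by simp [ae_iff]

theorem logRatio_ae : logRatio =ᵐ[volume]
    fun s => Real.log (s - 1) + Real.log (s + 1) - 2 * Real.log s := by
  filter_upwards [ae_ne_real 0, ae_ne_real 1, ae_ne_real (-1)] with s h0 h1 h2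
  simpa [Real.log_abs] using logRatio_div h0 h1 h2

theorem intervalIntegrable_log_shift (a b c : ℝ) :
    IntervalIntegrable (fun s => Real.log (s + c)) volume a b := by
  have := (intervalIntegral.intervalIntegrable_log' (a := a + c) (b := b + c)).comp_add_right c
  simpa using this

theorem integral_log_shift (a b c : ℝ) : ∫ s in a..b, Real.log (s + c) =
    (b + c) * Real.log (b + c) - (a + c) * Real.log (a + c) - (b - a) := by
  rw [intervalIntegral.integral_comp_add_right, integral_log]; ring

theorem intervalIntegrable_logRatio (a b : ℝ) : IntervalIntegrable logRatio volume a b := by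
  have := ((intervalIntegrable_log_shift a b (-1)).add (intervalIntegrable_log_shift a b 1)).sub
    ((intervalIntegrable_log_shift a b 0).const_mul 2)
  refine this.congr_ae (ae_restrict_of_ae ?_)
  filter_upwards [logRatio_ae] with s hs
  simp [hs, sub_eq_add_neg]

theorem integrable_logRatio : Integrable logRatio := by
  refine integrable_of_le_inv_one_add_sq (C := 2) (T := 2) (by norm_num) measurable_logRatio
    (intervalIntegrable_logRatio _ _) fun x hx => ?_
  have hx2 : 4 < x ^ 2 := by
    rw [← sq_abs]; nlinarith
  have h1 : (x ^ 2)⁻¹ ≤ 1 / 4 := by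
    rw [inv_le_comm₀ (by positivity) (by norm_num)]; norm_num; exact hx2.le
  have h0 : 0 < (x ^ 2)⁻¹ := by positivity
  have hpos : 0 < 1 - (x ^ 2)⁻¹ := by linarith
  have hlog := Real.one_sub_inv_le_log_of_pos hpos
  have hneg : Real.log (1 - (x ^ 2)⁻¹) ≤ 0 := Real.log_nonpos hpos.le (by linarith)
  rw [logRatio, abs_of_nonpos hneg]
  refine (neg_le_neg hlog).trans ?_
  have hx0 : x ^ 2 ≠ 0 := by linarith
  have hx1 : x ^ 2 - 1 ≠ 0 := by linarith
  have : 1 - (x ^ 2)⁻¹ = (x ^ 2 - 1) / x ^ 2 := by rw [sub_div, div_self hx0, one_div]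
  rw [this, inv_div, ← div_eq_mul_inv, neg_sub, div_sub_one hx1,
    div_le_div_iff₀ (by linarith) (by positivity)]
  nlinarith

/-- On `[-T, T]` the primitive is elementary. In the limit the terms `T log(1 - 1/T)` and `T log(1 +
1/T)` tend to `-1` and `1` and cancel. -/
theorem integral_logRatio : ∫ s, logRatio s = 0 := by
  have h1 := intervalIntegral_tendsto_integral integrable_logRatio tendsto_neg_atTop_atBot tendsto_id
  refine tendsto_nhds_unique h1 ?_
  have e : ∀ T : ℝ, 1 < T → (2 * (T * Real.log (1 + (-1) / T) + T * Real.log (1 + 1 / T)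
      + Real.log (1 + 1 / T) - Real.log (1 + (-1) / T))) = ∫ s in (-T)..id T, logRatio s := by
    intro T hT
    have hT0 : 0 < T := by linarith
    have : ∫ s in (-T)..id T, logRatio s = ∫ s in (-T)..T,
        (Real.log (s + -1) + Real.log (s + 1) - 2 * Real.log (s + 0)) := by
      refine intervalIntegral.integral_congr_ae ?_
      filter_upwards [logRatio_ae] with s hs _
      simp [hs, sub_eq_add_neg]
    rw [this, intervalIntegral.integral_sub
      ((intervalIntegrable_log_shift _ _ _).add (intervalIntegrable_log_shift _ _ _))
      ((intervalIntegrable_log_shift _ _ _).const_mul 2),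
      intervalIntegral.integral_add (intervalIntegrable_log_shift _ _ _)
      (intervalIntegrable_log_shift _ _ _), intervalIntegral.integral_const_mul,
      integral_log_shift, integral_log_shift, integral_log_shift]
    have a1 : -T + -1 = -(T + 1) := by ring
    have a2 : -T + 1 = -(T + -1) := by ring
    have a3 : -T + 0 = -T := by ring
    rw [a1, a2, a3, Real.log_neg_eq_log, Real.log_neg_eq_log, Real.log_neg_eq_log, add_zero]
    have b1 : 1 + -1 / T = (T + -1) / T := by field_simp
    have b2 : 1 + 1 / T = (T + 1) / T := by field_simp
    rw [b1, b2, Real.log_div (by linarith) hT0.ne', Real.log_div (by linarith) hT0.ne']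
    ring
  refine Tendsto.congr' (Filter.eventually_atTop.2 ⟨2, fun T hT => e T (by linarith)⟩) ?_
  have l : ∀ t : ℝ, Tendsto (fun T : ℝ => Real.log (1 + t / T)) atTop (𝓝 0) := fun t => by
    have h : Tendsto (fun T : ℝ => 1 + t / T) atTop (𝓝 (1 + 0)) :=
      tendsto_const_nhds.add (tendsto_const_nhds.div_atTop tendsto_id)
    simpa using h.log (by norm_num)
  have := ((((Real.tendsto_mul_log_one_add_div_atTop (-1)).add
    (Real.tendsto_mul_log_one_add_div_atTop 1)).add (l 1)).sub (l (-1))).const_mul 2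
  simpa using this

theorem integrable_logRatio_div (y : ℝ) : Integrable fun x => logRatio (x / y) := by
  rcases eq_or_ne y 0 with rfl | hy
  · simp [logRatio_zero]
  · exact integrable_logRatio.comp_div hy

theorem integral_logRatio_div (y : ℝ) : ∫ x, logRatio (x / y) = 0 := by
  rw [Measure.integral_comp_div, integral_logRatio, smul_zero]

/-- The linear growth in `y` is what makes a finite first moment the right hypothesis for Fubini. -/
theorem integral_norm_logRatio_div (y : ℝ) :
    ∫ x, ‖logRatio (x / y)‖ = |y| * ∫ x, ‖logRatio x‖ := by
  rw [Measure.integral_comp_div (fun s => ‖logRatio s‖), smul_eq_mul]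

/-- Fubini for the kernel `log |1 - y² / x²|` against a density with finite first moment. -/
theorem integrable_integral_logRatio {g : ℝ → ℝ} (hg : Measurable g)
    (hg1 : Integrable fun y => y * g y) :
    Integrable (fun x => ∫ y, logRatio (x / y) * g y) ∧
      (∫ x, ∫ y, logRatio (x / y) * g y) = 0 ∧
      ∀ᵐ x : ℝ, Integrable fun y => logRatio (x / y) * g y := by
  have hmeas : Measurable fun p : ℝ × ℝ => logRatio (p.1 / p.2) * g p.2 :=
    (measurable_logRatio.comp (measurable_fst.div measurable_snd)).mul (hg.comp measurable_snd)
  have hint : Integrable (fun p : ℝ × ℝ => logRatio (p.1 / p.2) * g p.2) (volume.prod volume) := by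
    rw [integrable_prod_iff' hmeas.aestronglyMeasurable]
    refine ⟨Eventually.of_forall fun y => (integrable_logRatio_div y).mul_const (g y), ?_⟩
    simp only [norm_mul, integral_mul_const, integral_norm_logRatio_div]
    have := (hg1.norm.mul_const (∫ x, ‖logRatio x‖))
    refine this.congr (Eventually.of_forall fun y => ?_)
    simp only [norm_mul, Real.norm_eq_abs]; ring
  refine ⟨hint.integral_prod_left, ?_, hint.prod_right_ae⟩
  rw [integral_integral_swap (f := fun x y => logRatio (x / y) * g y) hint]
  simp [integral_mul_const, integral_logRatio_div]

theorem integrable_log_one_add_sq_sub :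
    Integrable fun x : ℝ => Real.log (1 + x ^ 2) - 2 * Real.log |x| := by
  have hc : Continuous fun x : ℝ => Real.log (1 + x ^ 2) :=
    (by fun_prop : Continuous fun x : ℝ => 1 + x ^ 2).log fun x => by positivity
  refine integrable_of_le_inv_one_add_sq (C := 2) (T := 1) (by norm_num) (by fun_prop) ?_
    fun x hx => ?_
  · simp only [Real.log_abs]
    exact (hc.intervalIntegrable _ _).sub (intervalIntegral.intervalIntegrable_log'.const_mul 2)
  · have hx2 : 1 < x ^ 2 := by
      rw [← sq_abs]; nlinarith
    have hx0 : x ≠ 0 := by rintro rfl; norm_num at hx2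
    have e : Real.log (1 + x ^ 2) - 2 * Real.log |x| = Real.log (1 + (x ^ 2)⁻¹) := by
      have : 1 + (x ^ 2)⁻¹ = (1 + x ^ 2) / x ^ 2 := by field_simp; ring
      rw [this, Real.log_div (by positivity) (by positivity), Real.log_pow, Real.log_abs]
      simp
    have h0 : 0 < (x ^ 2)⁻¹ := by positivity
    rw [e, abs_of_nonneg (Real.log_nonneg (by linarith))]
    refine (Real.log_le_sub_one_of_pos (by linarith)).trans ?_
    rw [add_sub_cancel_left, ← div_eq_mul_inv, inv_eq_one_div,
      div_le_div_iff₀ (by positivity) (by positivity)]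
    nlinarith

/-- On `[-T, T]` the integral is `2T log(1 + T⁻²) + 4 arctan T`, of which only the arctangent
survives. -/
theorem integral_log_one_add_sq_sub :
    ∫ x : ℝ, (Real.log (1 + x ^ 2) - 2 * Real.log |x|) = 2 * Real.pi := by
  have h1 := intervalIntegral_tendsto_integral integrable_log_one_add_sq_sub
    tendsto_neg_atTop_atBot tendsto_id
  refine tendsto_nhds_unique h1 ?_
  have hc : Continuous fun x : ℝ => Real.log (1 + x ^ 2) :=
    (by fun_prop : Continuous fun x : ℝ => 1 + x ^ 2).log fun x => by positivity
  have hF : ∀ x : ℝ, HasDerivAt (fun x => x * Real.log (1 + x ^ 2) - 2 * x + 2 * Real.arctan x)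
      (Real.log (1 + x ^ 2)) x := fun x => by
    have hp : (1 : ℝ) + x ^ 2 ≠ 0 := by positivity
    have a : HasDerivAt (fun x : ℝ => 1 + x ^ 2) (2 * x) x := by
      simpa using (hasDerivAt_pow 2 x).const_add 1
    have := (((hasDerivAt_id' x).fun_mul (a.log hp)).fun_sub
      ((hasDerivAt_id' x).const_mul 2)).fun_add ((Real.hasDerivAt_arctan x).const_mul 2)
    refine this.congr_deriv ?_
    field_simp; ring
  have e : ∀ T : ℝ, 0 < T → 2 * (T * Real.log (1 + (T ^ 2)⁻¹)) + 4 * Real.arctan T =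
      ∫ x in (-T)..id T, (Real.log (1 + x ^ 2) - 2 * Real.log |x|) := fun T hT => by
    simp only [Real.log_abs, id]
    rw [intervalIntegral.integral_sub (hc.intervalIntegrable _ _)
      (intervalIntegral.intervalIntegrable_log'.const_mul 2),
      intervalIntegral.integral_const_mul, integral_log,
      intervalIntegral.integral_eq_sub_of_hasDerivAt (fun x _ => hF x)
        (hc.intervalIntegrable _ _)]
    have : 1 + (T ^ 2)⁻¹ = (1 + T ^ 2) / T ^ 2 := by field_simp; ring
    rw [this, Real.log_div (by positivity) (by positivity), Real.log_pow, Real.log_neg_eq_log,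
      Real.arctan_neg, neg_sq]
    push_cast; ring
  refine Tendsto.congr' (Filter.eventually_atTop.2 ⟨1, fun T hT => e T (by linarith)⟩) ?_
  have l1 : Tendsto (fun T : ℝ => T * Real.log (1 + (T ^ 2)⁻¹)) atTop (𝓝 0) := by
    refine Real.tendsto_mul_log_one_add_of_tendsto ?_
    refine tendsto_inv_atTop_zero.congr' ?_
    filter_upwards [eventually_gt_atTop 0] with T hT
    field_simp
  have := (l1.const_mul 2).add
    ((Real.tendsto_arctan_atTop.mono_right nhdsWithin_le_nhds).const_mul 4)
  convert this using 2
  ring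

/-! ### Potential and energy of a neutral even density -/

/-- Even densities on the line, asymptotic to `-κ / y²` at infinity, which are neutralised by two
atoms of mass `m`. -/
structure NeutralDensity (h : ℝ → ℝ) (m κ : ℝ) : Prop where
  measurable : Measurable h
  even : ∀ y, h (-y) = h y
  bound : ∃ C, ∀ y, |h y| ≤ C * (1 + y ^ 2)⁻¹
  moment : Integrable fun y => y * (h y + κ * (1 + y ^ 2)⁻¹)
  neutral : ∫ y, h y = -2 * m

namespace NeutralDensity

variable {h : ℝ → ℝ} {m κ : ℝ}

theorem integrable (H : NeutralDensity h m κ) : Integrable h := by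
  obtain ⟨C, hC⟩ := H.bound
  exact (integrable_inv_one_add_sq.const_mul C).mono' H.measurable.aestronglyMeasurable
    (Eventually.of_forall hC)

theorem integrable_log_mul (H : NeutralDensity h m κ) (x : ℝ) :
    Integrable fun y => Real.log |x - y| * h y := by
  obtain ⟨C, hC⟩ := H.bound
  have hm := H.measurable
  refine ((integral_log_div_one_add_sq x).1.norm.const_mul C).mono'
    (by fun_prop) (Eventually.of_forall fun y => ?_)
  have : 0 < (1 + y ^ 2)⁻¹ := by positivity
  simp only [norm_mul, Real.norm_eq_abs, abs_of_pos this]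
  calc _ ≤ abs (Real.log |x - y|) * (C * (1 + y ^ 2)⁻¹) :=
        mul_le_mul_of_nonneg_left (hC y) (abs_nonneg _)
    _ = _ := by ring

/-- Adding `κ/(1 + y²)` removes the `y⁻²` tail. By evenness `log|x - y|` may be replaced by the mean
of `log|x - y|` and `log|x + y|`, which is `logRatio (x / y) / 2 + log|x|`. -/
theorem integral_log_mul (H : NeutralDensity h m κ) {x : ℝ} (hx : x ≠ 0) :
    ∫ y, Real.log |x - y| * h y =
      1 / 2 * (∫ y, logRatio (x / y) * (h y + κ * (1 + y ^ 2)⁻¹)) +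
        Real.log |x| * (-2 * m + κ * Real.pi) - κ * (Real.pi / 2) * Real.log (1 + x ^ 2) := by
  set g : ℝ → ℝ := fun y => h y + κ * (1 + y ^ 2)⁻¹ with hg
  obtain ⟨c1, c2⟩ := integral_log_div_one_add_sq x
  have ig : Integrable g := H.integrable.add (integrable_inv_one_add_sq.const_mul κ)
  have hgi : ∫ y, g y = -2 * m + κ * Real.pi := by
    rw [hg, integral_add H.integrable (integrable_inv_one_add_sq.const_mul κ), H.neutral,
      integral_const_mul, integral_univ_inv_one_add_sq]
  have geven : ∀ y, g (-y) = g y := fun y => by simp only [hg, H.even, neg_sq]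
  have a1 : Integrable fun y => Real.log |x - y| * g y := by
    refine ((H.integrable_log_mul x).add (c1.const_mul κ)).congr (Eventually.of_forall fun y => ?_)
    simp only [hg, Pi.add_apply]; ring
  have e1 : ∫ y, Real.log |x - y| * g y =
      (∫ y, Real.log |x - y| * h y) + κ * (Real.pi / 2 * Real.log (1 + x ^ 2)) := by
    rw [← c2, ← integral_const_mul, ← integral_add (H.integrable_log_mul x) (c1.const_mul κ)]
    congr 1; ext y; simp only [hg]; ring
  have a2 : Integrable fun y => Real.log |x + y| * g y := by
    refine a1.comp_neg.congr (Eventually.of_forall fun y => ?_)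
    simp only [geven, sub_neg_eq_add]
  have e2 : ∫ y, Real.log |x + y| * g y = ∫ y, Real.log |x - y| * g y := by
    rw [← integral_neg_eq_self]
    congr 1; ext y; simp only [geven, ← sub_eq_add_neg]
  have a12 : Integrable fun y => Real.log |x - y| * g y + Real.log |x + y| * g y := a1.add a2
  have e3 : ∫ y, logRatio (x / y) * g y =
      (∫ y, Real.log |x - y| * g y) + (∫ y, Real.log |x + y| * g y) -
        2 * Real.log |x| * ∫ y, g y := by
    rw [← integral_const_mul, ← integral_add a1 a2, ← integral_sub a12 (ig.const_mul _)]
    refine integral_congr_ae ?_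
    filter_upwards [ae_ne_real x, ae_ne_real (-x)] with y h1 h2
    rw [logRatio_div hx h1.symm (fun h => h2 (by linarith))]
    ring
  rw [e3, e2, e1, hgi]; ring

/-- The potential, at `x`, of the density `h` together with atoms of mass `m` at `± q`. -/
noncomputable def pot (h : ℝ → ℝ) (m q x : ℝ) : ℝ :=
  (∫ y, Real.log |x - y| * -h y) - m * (Real.log |x - q| + Real.log |x + q|)

/-- Neutrality cancels the `m log|x|` contributions of density and atoms. Each of the three
remaining terms is integrable, and the first two have integral zero. -/
theorem pot_ae (H : NeutralDensity h m κ) (q : ℝ) : pot h m q =ᵐ[volume]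
    fun x => -(1 / 2) * (∫ y, logRatio (x / y) * (h y + κ * (1 + y ^ 2)⁻¹)) -
      m * logRatio (x / q) + κ * (Real.pi / 2) * (Real.log (1 + x ^ 2) - 2 * Real.log |x|) := by
  filter_upwards [ae_ne_real 0, ae_ne_real q, ae_ne_real (-q)] with x h0 h1 h2
  simp only [pot, mul_neg]
  rw [logRatio_div h0 h1 h2, integral_neg, H.integral_log_mul h0]
  ring

theorem integrable_pot (H : NeutralDensity h m κ) (q : ℝ) : Integrable (pot h m q) := by
  have hg : Measurable fun y => h y + κ * (1 + y ^ 2)⁻¹ := by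
    have := H.measurable; fun_prop
  exact Integrable.congr ((((integrable_integral_logRatio hg H.moment).1.const_mul _).sub
    ((integrable_logRatio_div q).const_mul m)).add
      (integrable_log_one_add_sq_sub.const_mul _)) (H.pot_ae q).symm

theorem integral_pot (H : NeutralDensity h m κ) (q : ℝ) :
    ∫ x, pot h m q x = κ * Real.pi ^ 2 := by
  have hg : Measurable fun y => h y + κ * (1 + y ^ 2)⁻¹ := by
    have := H.measurable; fun_prop
  obtain ⟨i1, e1, -⟩ := integrable_integral_logRatio hg H.moment
  have i2 : Integrable fun x =>
      -(1 / 2) * (∫ y, logRatio (x / y) * (h y + κ * (1 + y ^ 2)⁻¹)) - m * logRatio (x / q) :=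
    (i1.const_mul _).sub ((integrable_logRatio_div q).const_mul m)
  rw [integral_congr_ae (H.pot_ae q), integral_add i2 (integrable_log_one_add_sq_sub.const_mul _),
    integral_sub (i1.const_mul _) ((integrable_logRatio_div q).const_mul m), integral_const_mul,
    integral_const_mul, integral_const_mul, e1, integral_logRatio_div,
    integral_log_one_add_sq_sub]
  ring

theorem integrable_logKernel_dilate (H : NeutralDensity h m κ) (q : ℝ) {lam : ℝ} (hl : 0 < lam)
    (x : ℝ) : (dilate lam (twoAtomMeasure h m q)).Integrable (logKernel x) :=
  (logPotential_dilate hl H.integrable H.neutral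
    (fun x => by simpa [logKernel] using (H.integrable_log_mul x).neg) x).1

theorem logPotential_dilate_ae (H : NeutralDensity h m κ) (q : ℝ) {lam : ℝ} (hl : 0 < lam) :
    logPotential (dilate lam (twoAtomMeasure h m q)) =ᵐ[volume]
      fun x => lam * pot h m q (x / lam) := by
  filter_upwards [ae_ne_real (lam * q), ae_ne_real (-(lam * q))] with x h1 h2
  rw [(logPotential_dilate hl H.integrable H.neutral
    (fun x => by simpa [logKernel] using (H.integrable_log_mul x).neg) x).2, pot]
  have e1 : x / lam - q = (x - lam * q) / lam := by field_simp
  have e2 : x / lam + q = (x + lam * q) / lam := by field_simp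
  rw [e1, e2, abs_div, abs_div, abs_of_pos hl,
    Real.log_div (abs_ne_zero.2 (sub_ne_zero.2 h1)) hl.ne',
    Real.log_div (abs_ne_zero.2 fun h => h2 (by linarith)) hl.ne']
  ring

theorem integrable_logPotential_dilate (H : NeutralDensity h m κ) (q : ℝ) {lam : ℝ} (hl : 0 < lam) :
    Integrable (logPotential (dilate lam (twoAtomMeasure h m q))) :=
  (((H.integrable_pot q).comp_div hl.ne').const_mul lam).congr (H.logPotential_dilate_ae q hl).symm

theorem energyH_dilate (H : NeutralDensity h m κ) (q : ℝ) {lam : ℝ} (hl : 0 < lam) :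
    energyH (dilate lam (twoAtomMeasure h m q)) = lam ^ 2 * (κ * Real.pi ^ 2) := by
  rw [energyH, integral_congr_ae (H.logPotential_dilate_ae q hl), integral_const_mul,
    Measure.integral_comp_div, H.integral_pot, abs_of_pos hl, smul_eq_mul]
  ring

end NeutralDensity

/-! ### Charge neutrality of Types II and III by contour integration -/

open Complex in
/-- The square root on the closed upper half-plane with values in the closed first quadrant. -/
noncomputable def uhpSqrt (z : ℂ) : ℂ := ((1 + I) / (√2 : ℝ)) * (-I * z) ^ (2⁻¹ : ℂ)

theorem uhpSqrt_sq (z : ℂ) : uhpSqrt z ^ 2 = z := by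
  have h2 : ((√2 : ℝ) : ℂ) ^ 2 = 2 := by
    rw [← Complex.ofReal_pow, Real.sq_sqrt (by norm_num)]; norm_num
  have h3 : ((-Complex.I * z) ^ (2⁻¹ : ℂ)) ^ 2 = -Complex.I * z := by
    exact_mod_cast Complex.cpow_nat_inv_pow (-Complex.I * z) two_ne_zero
  rw [uhpSqrt, mul_pow, div_pow, h2, h3]
  linear_combination (-z - z * Complex.I / 2) * Complex.I_sq

/-- Since `-iz` lies in the closed right half-plane, its principal root lies in the sector `|Im| ≤
Re`, and the factor `(1 + i)/√2` rotates that sector onto the first quadrant. -/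
theorem uhpSqrt_re_im_nonneg {z : ℂ} (hz : 0 ≤ z.im) :
    0 ≤ (uhpSqrt z).re ∧ 0 ≤ (uhpSqrt z).im := by
  set w : ℂ := (-Complex.I * z) ^ (2⁻¹ : ℂ) with hw
  have h3 : w ^ 2 = -Complex.I * z := by
    exact_mod_cast Complex.cpow_nat_inv_pow (-Complex.I * z) two_ne_zero
  have hre : 0 ≤ w.re := by
    rw [hw, Complex.cpow_inv_two_re]; exact Real.sqrt_nonneg _
  have hsq : 0 ≤ w.re ^ 2 - w.im ^ 2 := by
    have := congrArg Complex.re h3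
    rw [pow_two, Complex.mul_re] at this
    simp at this
    nlinarith
  have him : |w.im| ≤ w.re := abs_le_of_sq_le_sq (by linarith) hre
  obtain ⟨h1, h2⟩ := abs_le.1 him
  have e : uhpSqrt z = ((√2)⁻¹ : ℝ) * ((1 + Complex.I) * w) := by
    rw [uhpSqrt, ← hw]; push_cast; ring
  have hs : 0 ≤ (√2)⁻¹ := by positivity
  rw [e, Complex.re_ofReal_mul, Complex.im_ofReal_mul]
  constructor <;> refine mul_nonneg hs ?_ <;> simp <;> linarith

theorem continuousOn_uhpSqrt : ContinuousOn uhpSqrt {z | 0 ≤ z.im} := by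
  intro z hz
  have h : ContinuousAt (fun x : ℂ => x ^ (2⁻¹ : ℂ)) (-Complex.I * z) :=
    Complex.continuousAt_cpow_const_of_re_pos (Or.inl (by simpa using hz)) (by norm_num)
  exact (continuousAt_const.mul
    (h.comp (f := fun z : ℂ => -Complex.I * z) (by fun_prop))).continuousWithinAt

theorem differentiableAt_uhpSqrt {z : ℂ} (hz : 0 ≤ z.im) (h0 : z ≠ 0) :
    DifferentiableAt ℂ uhpSqrt z := by
  refine DifferentiableAt.const_mul (DifferentiableAt.cpow (by fun_prop) (by fun_prop) ?_) _
  rw [Complex.mem_slitPlane_iff]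
  rcases hz.lt_or_eq with h | h
  · left; simpa using h
  · right
    have : z.re ≠ 0 := fun h' => h0 (Complex.ext h' h.symm)
    simpa using this

/-- The square fixes the value up to sign, and the quadrant fixes the sign. -/
theorem uhpSqrt_ofReal_of_nonneg {x : ℝ} (hx : 0 ≤ x) : uhpSqrt x = (√x : ℝ) := by
  obtain ⟨h1, h2⟩ := uhpSqrt_re_im_nonneg (z := (x : ℂ)) (by simp)
  have : uhpSqrt x ^ 2 = ((√x : ℝ) : ℂ) ^ 2 := by
    rw [uhpSqrt_sq, ← Complex.ofReal_pow, Real.sq_sqrt hx]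
  rcases sq_eq_sq_iff_eq_or_eq_neg.1 this with h | h
  · exact h
  · rw [h] at h1
    have h0 : √x = 0 := le_antisymm (by simpa using h1) (Real.sqrt_nonneg _)
    rw [h, h0]; simp

theorem uhpSqrt_ofReal_of_nonpos {x : ℝ} (hx : x ≤ 0) :
    uhpSqrt x = Complex.I * (√(-x) : ℝ) := by
  obtain ⟨h1, h2⟩ := uhpSqrt_re_im_nonneg (z := (x : ℂ)) (by simp)
  have : uhpSqrt x ^ 2 = (Complex.I * (√(-x) : ℝ)) ^ 2 := by
    rw [uhpSqrt_sq, mul_pow, ← Complex.ofReal_pow, Real.sq_sqrt (by linarith)]; simp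
  rcases sq_eq_sq_iff_eq_or_eq_neg.1 this with h | h
  · exact h
  · rw [h] at h2
    have h0 : √(-x) = 0 := le_antisymm (by simpa using h2) (Real.sqrt_nonneg _)
    rw [h, h0]; simp

/-- The branch of `√(z² - r²)` on the closed upper half-plane asymptotic to `z`. -/
noncomputable def uhpPair (r : ℝ) (z : ℂ) : ℂ := uhpSqrt (z - r) * uhpSqrt (z + r)

theorem uhpPair_sq (r : ℝ) (z : ℂ) : uhpPair r z ^ 2 = z ^ 2 - r ^ 2 := by
  rw [uhpPair, mul_pow, uhpSqrt_sq, uhpSqrt_sq]; ring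

/-- With `u`, `v` the two roots, `z = (u² + v²)/2`, and `Re(uv z̄) = (|u|² + |v|²)(Re u Re v + Im u
Im v)/2` is nonnegative because both roots lie in the first quadrant. So `uv` and `z` do not cancel.
-/
theorem norm_le_norm_uhpPair_add (r : ℝ) {z : ℂ} (hz : 0 ≤ z.im) : ‖z‖ ≤ ‖uhpPair r z + z‖ := by
  set u := uhpSqrt (z - r) with hu
  set v := uhpSqrt (z + r) with hv
  obtain ⟨u1, u2⟩ := uhpSqrt_re_im_nonneg (z := z - r) (by simpa using hz)
  obtain ⟨v1, v2⟩ := uhpSqrt_re_im_nonneg (z := z + r) (by simpa using hz)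
  rw [← hu] at u1 u2
  rw [← hv] at v1 v2
  have hz' : z = (u ^ 2 + v ^ 2) / 2 := by
    rw [hu, hv, uhpSqrt_sq, uhpSqrt_sq]; ring
  have hpair : uhpPair r z = u * v := rfl
  rw [hpair]
  refine le_of_sq_le_sq ?_ (norm_nonneg _) 
  rw [← Complex.normSq_eq_norm_sq, ← Complex.normSq_eq_norm_sq, Complex.normSq_add]
  have hre : 0 ≤ (u * v * (starRingEnd ℂ) z).re := by
    have hn : 0 ≤ (Complex.normSq u + Complex.normSq v) * (u.re * v.re + u.im * v.im) / 2 := by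
      have := Complex.normSq_nonneg u
      have := Complex.normSq_nonneg v
      positivity
    convert hn using 1
    have z1 : z.re = (u.re ^ 2 - u.im ^ 2 + v.re ^ 2 - v.im ^ 2) / 2 := by
      rw [hz']; simp [pow_two]; ring
    have z2 : z.im = u.re * u.im + v.re * v.im := by
      rw [hz']; simp [pow_two]; ring
    simp only [Complex.mul_re, Complex.mul_im, Complex.conj_re, Complex.conj_im, z1, z2,
      Complex.normSq_apply]
    ring
  nlinarith [Complex.normSq_nonneg (u * v)]

theorem norm_uhpPair_sub_le (r : ℝ) {z : ℂ} (hz : 0 ≤ z.im) (h0 : z ≠ 0) :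
    ‖uhpPair r z - z‖ ≤ r ^ 2 / ‖z‖ := by
  have hp : 0 < ‖z‖ := norm_pos_iff.2 h0
  rw [le_div_iff₀ hp]
  calc ‖uhpPair r z - z‖ * ‖z‖ ≤ ‖uhpPair r z - z‖ * ‖uhpPair r z + z‖ :=
        mul_le_mul_of_nonneg_left (norm_le_norm_uhpPair_add r hz) (norm_nonneg _)
    _ = ‖(r : ℂ) ^ 2‖ := by
        rw [← norm_mul, ← norm_neg]; congr 1
        linear_combination -uhpPair_sq r z
    _ = r ^ 2 := by simp

theorem continuousOn_uhpPair (r : ℝ) : ContinuousOn (uhpPair r) {z | 0 ≤ z.im} :=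
  (continuousOn_uhpSqrt.comp (f := fun z : ℂ => z - r) (by fun_prop)
    fun z hz => by simpa using hz).mul
  (continuousOn_uhpSqrt.comp (f := fun z : ℂ => z + r) (by fun_prop)
    fun z hz => by simpa using hz)

theorem differentiableAt_uhpPair (r : ℝ) {z : ℂ} (hz : 0 ≤ z.im) (h1 : z ≠ r) (h2 : z ≠ -r) :
    DifferentiableAt ℂ (uhpPair r) z :=
  ((differentiableAt_uhpSqrt (z := z - r) (by simpa using hz) (sub_ne_zero.2 h1)).comp z
    (f := fun z : ℂ => z - r) (by fun_prop)).mul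
  ((differentiableAt_uhpSqrt (z := z + r) (by simpa using hz)
    (fun h => h2 (eq_neg_of_add_eq_zero_left h))).comp z (f := fun z : ℂ => z + r) (by fun_prop))

theorem uhpPair_ofReal_of_le {r x : ℝ} (hr : 0 ≤ r) (hx : r ≤ x) :
    uhpPair r x = (√(x ^ 2 - r ^ 2) : ℝ) := by
  rw [uhpPair, ← Complex.ofReal_sub, ← Complex.ofReal_add,
    uhpSqrt_ofReal_of_nonneg (by linarith), uhpSqrt_ofReal_of_nonneg (by linarith),
    ← Complex.ofReal_mul, ← Real.sqrt_mul (by linarith)]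
  ring_nf

theorem uhpPair_ofReal_of_le_neg {r x : ℝ} (hr : 0 ≤ r) (hx : x ≤ -r) :
    uhpPair r x = -(√(x ^ 2 - r ^ 2) : ℝ) := by
  rw [uhpPair, ← Complex.ofReal_sub, ← Complex.ofReal_add,
    uhpSqrt_ofReal_of_nonpos (by linarith), uhpSqrt_ofReal_of_nonpos (by linarith),
    mul_mul_mul_comm, Complex.I_mul_I, ← Complex.ofReal_mul, ← Real.sqrt_mul (by linarith)]
  ring_nf

theorem uhpPair_ofReal_of_abs_le {r x : ℝ} (h1 : -r ≤ x) (h2 : x ≤ r) :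
    uhpPair r x = Complex.I * (√(r ^ 2 - x ^ 2) : ℝ) := by
  rw [uhpPair, ← Complex.ofReal_sub, ← Complex.ofReal_add,
    uhpSqrt_ofReal_of_nonpos (by linarith), uhpSqrt_ofReal_of_nonneg (by linarith),
    mul_assoc, ← Complex.ofReal_mul, ← Real.sqrt_mul (by linarith)]
  ring_nf

/-- A function holomorphic in the upper half-plane, continuous up to the boundary and
`O(z⁻²)` has vanishing integral over the real line. -/
theorem tendsto_integral_uhp {F : ℂ → ℂ} {C M : ℝ} (hc : ContinuousOn F {z | 0 ≤ z.im})
    (hd : ∀ z : ℂ, 0 < z.im → DifferentiableAt ℂ F z)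
    (hb : ∀ z : ℂ, 0 ≤ z.im → M ≤ ‖z‖ → ‖F z‖ ≤ C / ‖z‖ ^ 2) :
    Tendsto (fun T : ℝ => ∫ x in (-T)..T, F x) atTop (𝓝 0) := by
  have hC : ∀ T : ℝ, 0 < T → M ≤ T → ∀ z : ℂ, 0 ≤ z.im → T ≤ ‖z‖ → ‖F z‖ ≤ |C| / T ^ 2 :=
    fun T hT hM z hz hzT => by
      refine (hb z hz (hM.trans hzT)).trans ?_
      gcongr
      exact le_abs_self C
  have key : ∀ T : ℝ, 0 < T → M ≤ T → ‖∫ x in (-T)..T, F x‖ ≤ 4 * |C| / T := fun T hT hM => by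
    -- On the rectangle `[-T, T] × [0, T]` the three sides off the real axis have total length `4T`
    -- and lie in `|z| ≥ T`, so they contribute `O(1/T)`.
    have hrect := Complex.integral_boundary_rect_eq_zero_of_continuousOn_of_differentiableOn F
      (-T : ℂ) (T + T * Complex.I) (hc.mono ?_) ?_
    · simp only [Complex.neg_re, Complex.ofReal_re, Complex.neg_im, Complex.ofReal_im, neg_zero,
        Complex.add_re, Complex.mul_re, Complex.I_re, mul_zero, Complex.I_im, mul_one, sub_self,
        add_zero, Complex.add_im, Complex.mul_im, zero_add, zero_mul,
        Complex.ofReal_zero] at hrect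
      push_cast at hrect
      have b1 : ‖∫ x : ℝ in (-T)..T, F (x + T * Complex.I)‖ ≤ |C| / T ^ 2 * |T - -T| :=
        intervalIntegral.norm_integral_le_of_norm_le_const fun x _ => hC T hT hM _
          (by simp [hT.le]) ((le_abs_self T).trans (by
            simpa using Complex.abs_im_le_norm (x + T * Complex.I)))
      have b2 : ‖∫ y : ℝ in (0)..T, F (T + y * Complex.I)‖ ≤ |C| / T ^ 2 * |T - 0| :=
        intervalIntegral.norm_integral_le_of_norm_le_const fun y hy => hC T hT hM _
          (by rw [uIoc_of_le hT.le] at hy; simpa using hy.1.le) ((le_abs_self T).trans (by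
            simpa using Complex.abs_re_le_norm (T + y * Complex.I)))
      have b3 : ‖∫ y : ℝ in (0)..T, F (-T + y * Complex.I)‖ ≤ |C| / T ^ 2 * |T - 0| :=
        intervalIntegral.norm_integral_le_of_norm_le_const fun y hy => hC T hT hM _
          (by rw [uIoc_of_le hT.le] at hy; simpa using hy.1.le) ((le_abs_self T).trans (by
            simpa using Complex.abs_re_le_norm (-T + y * Complex.I)))
      have e : ∫ x in (-T)..T, F x = (∫ x : ℝ in (-T)..T, F (x + T * Complex.I)) -
          Complex.I • (∫ y : ℝ in (0)..T, F (T + y * Complex.I)) +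
          Complex.I • (∫ y : ℝ in (0)..T, F (-T + y * Complex.I)) := by
        linear_combination hrect
      rw [e]
      refine (norm_add_le _ _).trans ((add_le_add_left (norm_sub_le _ _) _).trans ?_)
      rw [norm_smul, norm_smul, Complex.norm_I, one_mul, one_mul]
      have ht : |T - -T| = 2 * T := by rw [abs_of_pos] <;> linarith
      have ht' : |T - 0| = T := by rw [abs_of_pos] <;> linarith
      rw [ht] at b1
      rw [ht'] at b2 b3
      have : 4 * |C| / T = |C| / T ^ 2 * (2 * T) + |C| / T ^ 2 * T + |C| / T ^ 2 * T := by
        field_simp; ring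
      linarith
    · intro z hz
      have := hz.2
      simp [uIcc_of_le hT.le] at this
      exact this.1
    · intro z hz
      refine (hd z ?_).differentiableWithinAt
      have := hz.2
      simp [hT.le] at this
      exact this.1
  rw [tendsto_zero_iff_norm_tendsto_zero]
  refine squeeze_zero' (Eventually.of_forall fun _ => norm_nonneg _)
    (by filter_upwards [eventually_gt_atTop 0, eventually_ge_atTop M] with T h1 h2 using key T h1 h2)
    (tendsto_const_nhds.div_atTop tendsto_id)

/-- The branch of `√((z² - R²)(z² - L²))` on the closed upper half-plane asymptotic to `z²`. -/
noncomputable def uhpQuartic (L R : ℝ) (z : ℂ) : ℂ := uhpPair R z * uhpPair L z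

/-- The atom parameter `√((R² - 1)(1 - L²))`. -/
noncomputable def gammaIII (L R : ℝ) : ℝ := √((R ^ 2 - 1) * (1 - L ^ 2))

section

variable {L R : ℝ}

theorem uhpQuartic_one (hL : 0 ≤ L) (hL1 : L < 1) (hR : 1 < R) :
    uhpQuartic L R 1 = Complex.I * gammaIII L R := by
  have h1 := uhpPair_ofReal_of_abs_le (r := R) (x := 1) (by linarith) (by linarith)
  have h2 := uhpPair_ofReal_of_le (r := L) (x := 1) hL hL1.le
  rw [Complex.ofReal_one] at h1 h2
  rw [uhpQuartic, h1, h2, gammaIII, Real.sqrt_mul (by nlinarith)]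
  push_cast; simp; ring

theorem uhpQuartic_neg_one (hL : 0 ≤ L) (hL1 : L < 1) (hR : 1 < R) :
    uhpQuartic L R (-1) = -(Complex.I * gammaIII L R) := by
  have h1 := uhpPair_ofReal_of_abs_le (r := R) (x := -1) (by linarith) (by linarith)
  have h2 := uhpPair_ofReal_of_le_neg (r := L) (x := -1) hL (by linarith)
  rw [Complex.ofReal_neg, Complex.ofReal_one] at h1 h2
  rw [uhpQuartic, h1, h2, gammaIII, Real.sqrt_mul (by nlinarith)]
  push_cast; simp; ring

/-- The boundary values are nonnegative for `|x| ≥ R`, nonpositive for `|x| ≤ L` and imaginary on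
the gaps. These signs match those of `x² - 1`, which produces the absolute value in the density. -/
theorem re_uhpQuartic_div (hL : 0 ≤ L) (hL1 : L < 1) (hR : 1 < R) (x : ℝ) :
    (uhpQuartic L R x).re / (x ^ 2 - 1) = densityIII L R x + 1 := by
  rw [densityIII, indicator_apply]
  simp only [mem_ofPred_eq]
  rcases le_total R x with h | h
  · rw [if_pos (Or.inr (h.trans (le_abs_self x))), uhpQuartic,
      uhpPair_ofReal_of_le (by linarith) h, uhpPair_ofReal_of_le hL (by linarith),
      ← Complex.ofReal_mul, Complex.ofReal_re, ← Real.sqrt_mul (by nlinarith),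
      abs_of_nonneg (by nlinarith)]
    ring
  rcases le_total x (-R) with h' | h'
  · rw [if_pos (Or.inr ((by linarith : R ≤ -x).trans (neg_le_abs x))), uhpQuartic,
      uhpPair_ofReal_of_le_neg (by linarith) h', uhpPair_ofReal_of_le_neg hL (by linarith),
      neg_mul_neg, ← Complex.ofReal_mul, Complex.ofReal_re, ← Real.sqrt_mul (by nlinarith),
      abs_of_nonneg (by nlinarith)]
    ring
  rw [uhpQuartic, uhpPair_ofReal_of_abs_le h' h]
  rcases le_or_gt |x| L with hx | hx
  · obtain ⟨h1, h2⟩ := abs_le.1 hx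
    have hx1 : x ^ 2 < 1 := by nlinarith
    rw [if_pos (Or.inl hx), uhpPair_ofReal_of_abs_le h1 h2, mul_mul_mul_comm, Complex.I_mul_I,
      ← Complex.ofReal_mul, ← Real.sqrt_mul (by nlinarith), abs_of_neg (by linarith),
      ← neg_mul_neg (x ^ 2 - R ^ 2)]
    simp only [neg_sub, neg_mul, one_mul, Complex.neg_re, Complex.ofReal_re]
    rw [← neg_sub 1 (x ^ 2), neg_div_neg_eq]
    ring
  · have hzero : ∀ s : ℝ, (Complex.I * (√(R ^ 2 - x ^ 2) : ℝ) * (s : ℂ)).re = 0 := fun s => by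
      simp
    have hre : (Complex.I * (√(R ^ 2 - x ^ 2) : ℝ) * uhpPair L x).re = 0 := by
      rcases lt_abs.1 hx with h1 | h1
      · rw [uhpPair_ofReal_of_le hL h1.le]; exact hzero _
      · rw [uhpPair_ofReal_of_le_neg hL (by linarith), ← Complex.ofReal_neg]; exact hzero _
    rw [hre]
    by_cases hxR : R ≤ |x|
    · have : |x| = R := le_antisymm (abs_le.2 ⟨h', h⟩) hxR
      have hxx : x ^ 2 - R ^ 2 = 0 := by rw [← sq_abs, this]; ring
      simp [hxx]
    · rw [if_neg (by push Not; exact ⟨hx, not_le.1 hxR⟩)]; simp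

theorem continuousOn_uhpQuartic : ContinuousOn (uhpQuartic L R) {z | 0 ≤ z.im} :=
  (continuousOn_uhpPair R).mul (continuousOn_uhpPair L)

theorem differentiableAt_uhpQuartic {z : ℂ} (hz : 0 ≤ z.im) (h1 : z ≠ R) (h2 : z ≠ -R)
    (h3 : z ≠ L) (h4 : z ≠ -L) : DifferentiableAt ℂ (uhpQuartic L R) z :=
  (differentiableAt_uhpPair R hz h1 h2).mul (differentiableAt_uhpPair L hz h3 h4)

theorem norm_uhpQuartic_sub_le {z : ℂ} (hz : 0 ≤ z.im) (h1 : 1 ≤ ‖z‖) :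
    ‖uhpQuartic L R z - z ^ 2‖ ≤ R ^ 2 * (1 + L ^ 2) + L ^ 2 := by
  have h0 : z ≠ 0 := norm_pos_iff.1 (by linarith)
  have hp : 0 < ‖z‖ := by linarith
  have a := norm_uhpPair_sub_le R hz h0
  have b := norm_uhpPair_sub_le L hz h0
  have b' : ‖uhpPair L z‖ ≤ ‖z‖ + L ^ 2 / ‖z‖ := by
    have := norm_add_le (uhpPair L z - z) z
    rw [sub_add_cancel] at this; linarith
  have e : uhpQuartic L R z - z ^ 2 =
      (uhpPair R z - z) * uhpPair L z + z * (uhpPair L z - z) := by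
    rw [uhpQuartic]; ring
  rw [e]
  refine (norm_add_le _ _).trans ?_
  rw [norm_mul, norm_mul]
  have c1 : ‖uhpPair R z - z‖ * ‖uhpPair L z‖ ≤ R ^ 2 * (1 + L ^ 2) := by
    calc _ ≤ R ^ 2 / ‖z‖ * (‖z‖ + L ^ 2 / ‖z‖) := by gcongr
      _ = R ^ 2 * (1 + L ^ 2 / ‖z‖ ^ 2) := by field_simp
      _ ≤ R ^ 2 * (1 + L ^ 2) := by
        gcongr
        exact div_le_self (sq_nonneg L) (one_le_pow₀ h1)
  have c2 : ‖z‖ * ‖uhpPair L z - z‖ ≤ L ^ 2 := by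
    calc _ ≤ ‖z‖ * (L ^ 2 / ‖z‖) := by gcongr
      _ = L ^ 2 := by field_simp
  linarith

/-- A holomorphic extension of `densityIII L R`, up to an explicit Poisson kernel. -/
noncomputable def uhpDensity (L R : ℝ) (z : ℂ) : ℂ :=
  dslope (dslope (fun w => uhpQuartic L R w - Complex.I * gammaIII L R * w) 1) (-1) z - 1 +
    Complex.I * gammaIII L R / (z + Complex.I)

/-- The linear function `iγz` agrees with `uhpQuartic` at both `1` and `-1`, so the quotient has
removable singularities there, filled in by the two `dslope`s. The term `iγ/(z + i)` cancels the
`1/z` tail that `iγz` creates; its real part on the line is the Poisson kernel `γ/(1 + x²)`. -/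
theorem uhpDensity_of_ne (hL : 0 ≤ L) (hL1 : L < 1) (hR : 1 < R) {z : ℂ} (h1 : z ≠ 1)
    (h2 : z ≠ -1) : uhpDensity L R z =
      (uhpQuartic L R z - Complex.I * gammaIII L R * z) / (z ^ 2 - 1) - 1 +
        Complex.I * gammaIII L R / (z + Complex.I) := by
  have e1 : z - 1 ≠ 0 := sub_ne_zero.2 h1
  have e2 : z + 1 ≠ 0 := fun h => h2 (eq_neg_of_add_eq_zero_left h)
  have e3 : z ^ 2 - 1 = (z - 1) * (z + 1) := by ring
  rw [uhpDensity, dslope_of_ne _ h2, slope_def_field, dslope_of_ne _ h1, slope_def_field,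
    dslope_of_ne _ (by norm_num : (-1 : ℂ) ≠ 1), slope_def_field, uhpQuartic_one hL hL1 hR,
    uhpQuartic_neg_one hL hL1 hR, e3]
  congr 2
  rw [sub_neg_eq_add]
  field_simp
  ring

theorem im_add_I_ne_zero {z : ℂ} (hz : 0 ≤ z.im) : z + Complex.I ≠ 0 := fun h => by
  have := congrArg Complex.im h
  simp at this
  linarith

theorem continuousOn_uhpDensity (hL : 0 ≤ L) (hL1 : L < 1) (hR : 1 < R) :
    ContinuousOn (uhpDensity L R) {z | 0 ≤ z.im} := by
  have d1 : DifferentiableAt ℂ (fun w => uhpQuartic L R w - Complex.I * gammaIII L R * w) 1 := by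
    refine (differentiableAt_uhpQuartic (by simp) ?_ ?_ ?_ ?_).fun_sub (by fun_prop)
    · exact_mod_cast hR.ne
    · intro h; have : (1 : ℝ) = -R := by exact_mod_cast h
      linarith
    · exact_mod_cast hL1.ne'
    · intro h; have : (1 : ℝ) = -L := by exact_mod_cast h
      linarith
  have d2 : DifferentiableAt ℂ (fun w => uhpQuartic L R w - Complex.I * gammaIII L R * w)
      (-1) := by
    refine (differentiableAt_uhpQuartic (by simp) ?_ ?_ ?_ ?_).fun_sub (by fun_prop)
    · intro h; have : (-1 : ℝ) = R := by exact_mod_cast h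
      linarith
    · intro h; have : (-1 : ℝ) = -R := by exact_mod_cast h
      linarith
    · intro h; have : (-1 : ℝ) = L := by exact_mod_cast h
      linarith
    · intro h; have : (-1 : ℝ) = -L := by exact_mod_cast h
      linarith
  have c0 : ContinuousOn (fun w => uhpQuartic L R w - Complex.I * gammaIII L R * w)
      {z | 0 ≤ z.im} := continuousOn_uhpQuartic.sub (by fun_prop)
  have c1 : ContinuousOn (dslope (fun w => uhpQuartic L R w - Complex.I * gammaIII L R * w) 1)
      {z | 0 ≤ z.im} := fun z hz => by
    rcases eq_or_ne z 1 with rfl | h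
    · exact (continuousAt_dslope_same.2 d1).continuousWithinAt
    · exact (continuousWithinAt_dslope_of_ne h).2 (c0 z hz)
  have c2 : ContinuousOn (dslope (dslope (fun w => uhpQuartic L R w -
      Complex.I * gammaIII L R * w) 1) (-1)) {z | 0 ≤ z.im} := fun z hz => by
    rcases eq_or_ne z (-1) with rfl | h
    · exact (continuousAt_dslope_same.2
        ((differentiableAt_dslope_of_ne (by norm_num)).2 d2)).continuousWithinAt
    · exact (continuousWithinAt_dslope_of_ne h).2 (c1 z hz)
  exact (c2.sub continuousOn_const).add (continuousOn_const.div (by fun_prop)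
    fun z hz => im_add_I_ne_zero hz)

theorem differentiableAt_uhpDensity {z : ℂ} (hz : 0 < z.im) :
    DifferentiableAt ℂ (uhpDensity L R) z := by
  have hne : ∀ w : ℂ, w.im = 0 → z ≠ w := fun w hw h => by rw [h, hw] at hz; exact lt_irrefl _ hz
  have d : DifferentiableAt ℂ (dslope (dslope (fun w => uhpQuartic L R w -
      Complex.I * gammaIII L R * w) 1) (-1)) z := by
    rw [differentiableAt_dslope_of_ne (hne _ (by simp)),
      differentiableAt_dslope_of_ne (hne _ (by simp))]
    exact (differentiableAt_uhpQuartic hz.le (hne _ (by simp)) (hne _ (by simp))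
      (hne _ (by simp)) (hne _ (by simp))).fun_sub (by fun_prop)
  exact (d.sub_const 1).fun_add ((differentiableAt_const _).fun_div (by fun_prop)
    (im_add_I_ne_zero hz.le))

theorem norm_uhpDensity_le (hL : 0 ≤ L) (hL1 : L < 1) (hR : 1 < R) {z : ℂ} (hz : 0 ≤ z.im)
    (h2 : 2 ≤ ‖z‖) : ‖uhpDensity L R z‖ ≤
      (2 * (R ^ 2 * (1 + L ^ 2) + L ^ 2 + 1) + 2 * gammaIII L R) / ‖z‖ ^ 2 := by
  have hp : 0 < ‖z‖ := by linarith
  have hg : 0 ≤ gammaIII L R := Real.sqrt_nonneg _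
  have h1 : z ≠ 1 := by rintro rfl; norm_num at h2
  have h1' : z ≠ -1 := by rintro rfl; norm_num at h2
  have hsub : ‖z‖ ^ 2 / 2 ≤ ‖z ^ 2 - 1‖ := by
    have := norm_sub_norm_le (z ^ 2) 1
    rw [norm_pow, norm_one] at this
    nlinarith
  have hne : z ^ 2 - 1 ≠ 0 := norm_pos_iff.1 (lt_of_lt_of_le (by positivity) hsub)
  have hI := im_add_I_ne_zero hz
  have hI2 : ‖z - Complex.I‖ ≤ ‖z + Complex.I‖ := by
    rw [← abs_norm, ← abs_norm (z + Complex.I), ← sq_le_sq, ← Complex.normSq_eq_norm_sq,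
      ← Complex.normSq_eq_norm_sq, Complex.normSq_apply, Complex.normSq_apply]
    simp; nlinarith
  -- Both numerators are now bounded: the first by the expansion of `uhpQuartic`, the second because
  -- `|z - i| ≤ |z + i|` in the upper half-plane.
  have e : uhpDensity L R z = (uhpQuartic L R z - z ^ 2 + 1) / (z ^ 2 - 1) +
      gammaIII L R * ((z - Complex.I) / (z + Complex.I)) / (z ^ 2 - 1) := by
    rw [uhpDensity_of_ne hL hL1 hR h1 h1']
    field_simp
    linear_combination (-(gammaIII L R : ℂ) * z) * Complex.I_sq
  have b1 : ‖uhpQuartic L R z - z ^ 2 + 1‖ ≤ R ^ 2 * (1 + L ^ 2) + L ^ 2 + 1 := by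
    refine (norm_add_le _ _).trans ?_
    rw [norm_one]
    have := norm_uhpQuartic_sub_le (L := L) (R := R) hz (by linarith)
    linarith
  have b2 : ‖(gammaIII L R : ℂ) * ((z - Complex.I) / (z + Complex.I))‖ ≤ gammaIII L R := by
    rw [norm_mul, norm_div, Complex.norm_real, Real.norm_of_nonneg hg]
    exact mul_le_of_le_one_right hg (div_le_one_of_le₀ hI2 (norm_nonneg _))
  rw [e, ← add_div, norm_div]
  calc _ ≤ (R ^ 2 * (1 + L ^ 2) + L ^ 2 + 1 + gammaIII L R) / (‖z‖ ^ 2 / 2) := by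
        gcongr
        exact (norm_add_le _ _).trans (add_le_add b1 b2)
    _ = _ := by field_simp

theorem re_uhpDensity (hL : 0 ≤ L) (hL1 : L < 1) (hR : 1 < R) {x : ℝ} (h1 : x ≠ 1)
    (h2 : x ≠ -1) :
    (uhpDensity L R x).re = densityIII L R x + gammaIII L R * (1 + x ^ 2)⁻¹ := by
  have e1 : (uhpQuartic L R x - Complex.I * gammaIII L R * x) / ((x : ℂ) ^ 2 - 1) =
      (uhpQuartic L R x - Complex.I * ((gammaIII L R * x : ℝ) : ℂ)) / ((x ^ 2 - 1 : ℝ) : ℂ) := by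
    push_cast; ring
  have e2 : Complex.I * gammaIII L R / ((x : ℂ) + Complex.I) =
      ((gammaIII L R * (1 + x ^ 2)⁻¹ : ℝ) : ℂ) * (1 + Complex.I * x) := by
    have : (1 : ℂ) + (x : ℂ) ^ 2 ≠ 0 := by
      exact_mod_cast (by positivity : (1 : ℝ) + x ^ 2 ≠ 0)
    rw [div_eq_iff (im_add_I_ne_zero (by simp))]
    push_cast
    field_simp
    linear_combination (-(gammaIII L R : ℂ) * x) * Complex.I_sq
  rw [uhpDensity_of_ne hL hL1 hR (by exact_mod_cast h1) (by exact_mod_cast h2), e1, e2,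
    Complex.add_re, Complex.sub_re, Complex.div_ofReal_re, Complex.re_ofReal_mul, Complex.sub_re]
  simp only [Complex.mul_re, Complex.I_re, Complex.I_im, Complex.ofReal_im, Complex.ofReal_re,
    Complex.add_re, Complex.one_re, mul_zero, zero_mul, sub_zero, add_zero, mul_one]
  rw [re_uhpQuartic_div hL hL1 hR]
  ring

/-- Charge neutrality of the Type III distributions. -/
theorem integral_densityIII (hL : 0 ≤ L) (hL1 : L < 1) (hR : 1 < R)
    (hi : Integrable (densityIII L R)) : ∫ x, densityIII L R x = -Real.pi * gammaIII L R := by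
  have hF := tendsto_integral_uhp (continuousOn_uhpDensity hL hL1 hR)
    (fun z hz => differentiableAt_uhpDensity hz)
    (fun z hz h2 => norm_uhpDensity_le hL hL1 hR hz h2)
  have hi2 : Integrable fun x => densityIII L R x + gammaIII L R * (1 + x ^ 2)⁻¹ :=
    hi.add (integrable_inv_one_add_sq.const_mul _)
  have hlim := intervalIntegral_tendsto_integral hi2 tendsto_neg_atTop_atBot tendsto_id
  have hcont : Continuous fun x : ℝ => uhpDensity L R x :=
    (continuousOn_uhpDensity hL hL1 hR).comp_continuous Complex.continuous_ofReal
      fun x => by simp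
  have hre : ∀ T : ℝ, (∫ x in (-T)..T, uhpDensity L R x).re =
      ∫ x in (-T)..id T, (densityIII L R x + gammaIII L R * (1 + x ^ 2)⁻¹) := fun T => by
    rw [← Complex.reCLM_apply, ← ContinuousLinearMap.intervalIntegral_comp_comm _
      (hcont.intervalIntegrable _ _)]
    refine intervalIntegral.integral_congr_ae ?_
    filter_upwards [ae_ne_real 1, ae_ne_real (-1)] with x h1 h2 _
    exact re_uhpDensity hL hL1 hR h1 h2
  have h0 : Tendsto (fun T : ℝ => (∫ x in (-T)..T, uhpDensity L R x).re) atTop (𝓝 0) := by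
    simpa [Function.comp_def] using (Complex.continuous_re.tendsto 0).comp hF
  simp_rw [hre] at h0
  have := tendsto_nhds_unique hlim h0
  rw [integral_add hi (integrable_inv_one_add_sq.const_mul _), integral_const_mul,
    integral_univ_inv_one_add_sq] at this
  linarith

end

/-! ### Tail expansion of the densities -/

/-- With `κ = (A - B)/2` one has `N² - (u - κ)² = -(AB + κ²)`, hence `N = u - κ + O(1/u)`. It is
applied with `t = 1 + y²` and `u = y² - 1` or `u = y²`; `η` compares `u` with `t`. -/
theorem abs_sqrt_div_sub_one_add_le {u t A B N η : ℝ} (hu : 0 < u) (hAu : A ≤ u) (hA : 0 ≤ A)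
    (hB : 0 ≤ B) (hN : 0 ≤ N) (hN2 : N ^ 2 = (u - A) * (u + B)) (ht : 0 < t) (htu : |t - u| ≤ 2)
    (hη : 0 < η) (hηu : η * t ≤ u) :
    |N / u - 1 + (A - B) / 2 * t⁻¹| ≤
      (2 * (A * B + ((A - B) / 2) ^ 2) / η ^ 2 + 2 * |(A - B) / 2| / η) * t⁻¹ ^ 2 := by
  set κ := (A - B) / 2 with hκ
  have hs : u / 2 ≤ u - κ := by rw [hκ]; linarith
  have hK : 0 ≤ A * B + κ ^ 2 := by positivity
  have e1 : N / u - 1 + κ * t⁻¹ = (N - (u - κ)) / u - κ * (t - u) / (u * t) := by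
    field_simp; ring
  have e2 : (N - (u - κ)) * (N + (u - κ)) = -(A * B + κ ^ 2) := by
    rw [hκ]; linear_combination hN2
  have b1 : |N - (u - κ)| ≤ 2 * (A * B + κ ^ 2) / u := by
    rw [le_div_iff₀ hu]
    have h3 : |N - (u - κ)| * (N + (u - κ)) = A * B + κ ^ 2 := by
      rw [← abs_of_nonneg (by linarith : 0 ≤ N + (u - κ)), ← abs_mul, e2, abs_neg,
        abs_of_nonneg hK]
    nlinarith [abs_nonneg (N - (u - κ))]
  rw [e1]
  refine (abs_sub _ _).trans ?_
  rw [abs_div, abs_div, abs_mul, abs_of_pos hu, abs_of_pos (mul_pos hu ht)]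
  have c1 : |N - (u - κ)| / u ≤ 2 * (A * B + κ ^ 2) / (η * t) ^ 2 := by
    calc _ ≤ 2 * (A * B + κ ^ 2) / u / u := by gcongr
      _ = 2 * (A * B + κ ^ 2) / u ^ 2 := by field_simp
      _ ≤ _ := by gcongr
  have c2 : |κ| * |t - u| / (u * t) ≤ |κ| * 2 / (η * t * t) := by gcongr
  calc _ ≤ 2 * (A * B + κ ^ 2) / (η * t) ^ 2 + |κ| * 2 / (η * t * t) := add_le_add c1 c2
    _ = _ := by field_simp

theorem abs_le_of_asymptotic {h : ℝ → ℝ} {κ C : ℝ}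
    (hb : ∀ y, |h y + κ * (1 + y ^ 2)⁻¹| ≤ C * (1 + y ^ 2)⁻¹ ^ 2) (y : ℝ) :
    |h y| ≤ (|C| + |κ|) * (1 + y ^ 2)⁻¹ := by
  have hp : 0 < (1 + y ^ 2)⁻¹ := by positivity
  have h1 : (1 + y ^ 2)⁻¹ ≤ 1 := inv_le_one_of_one_le₀ (by nlinarith)
  have e : h y = (h y + κ * (1 + y ^ 2)⁻¹) - κ * (1 + y ^ 2)⁻¹ := by ring
  rw [e]
  refine (abs_sub _ _).trans ?_
  rw [abs_mul, abs_of_pos hp, add_mul]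
  gcongr
  refine (hb y).trans ?_
  have : (1 + y ^ 2)⁻¹ ^ 2 ≤ (1 + y ^ 2)⁻¹ := by nlinarith
  calc C * (1 + y ^ 2)⁻¹ ^ 2 ≤ |C| * (1 + y ^ 2)⁻¹ ^ 2 := by gcongr; exact le_abs_self C
    _ ≤ _ := by gcongr

theorem integrable_of_asymptotic {h : ℝ → ℝ} {κ C : ℝ} (hm : Measurable h)
    (hb : ∀ y, |h y + κ * (1 + y ^ 2)⁻¹| ≤ C * (1 + y ^ 2)⁻¹ ^ 2) : Integrable h :=
  (integrable_inv_one_add_sq.const_mul _).mono' hm.aestronglyMeasurable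
    (Eventually.of_forall (abs_le_of_asymptotic hb))

theorem NeutralDensity.of_asymptotic {h : ℝ → ℝ} {m κ C : ℝ} (hm : Measurable h)
    (heven : ∀ y, h (-y) = h y)
    (hb : ∀ y, |h y + κ * (1 + y ^ 2)⁻¹| ≤ C * (1 + y ^ 2)⁻¹ ^ 2)
    (hn : ∫ y, h y = -2 * m) : NeutralDensity h m κ where
  measurable := hm
  even := heven
  bound := ⟨_, abs_le_of_asymptotic hb⟩
  moment := by
    refine (integrable_inv_one_add_sq.const_mul |C|).mono' (by fun_prop)
      (Eventually.of_forall fun y => ?_)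
    have hp : 0 < (1 + y ^ 2)⁻¹ := by positivity
    rw [norm_mul, Real.norm_eq_abs, Real.norm_eq_abs]
    have h1 : |y| * (1 + y ^ 2)⁻¹ ≤ 1 := by
      rw [← div_eq_mul_inv, div_le_one (by positivity)]
      nlinarith [sq_abs y, sq_nonneg (|y| - 1), abs_nonneg y]
    calc |y| * |h y + κ * (1 + y ^ 2)⁻¹| ≤ |y| * (|C| * (1 + y ^ 2)⁻¹ ^ 2) := by
          gcongr
          exact (hb y).trans (by gcongr; exact le_abs_self C)
      _ = |C| * (|y| * (1 + y ^ 2)⁻¹) * (1 + y ^ 2)⁻¹ := by ring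
      _ ≤ |C| * 1 * (1 + y ^ 2)⁻¹ := by gcongr
      _ = _ := by ring
  neutral := hn

section

variable {L R : ℝ}

theorem measurable_densityIII : Measurable (densityIII L R) := by
  unfold densityIII
  refine measurable_const.add (Measurable.indicator (by fun_prop) ?_)
  exact (measurableSet_le (f := fun y : ℝ => |y|) (by fun_prop) measurable_const).union
    (measurableSet_le (g := fun y : ℝ => |y|) measurable_const (by fun_prop))

theorem densityIII_neg (x : ℝ) : densityIII L R (-x) = densityIII L R x := by
  simp [densityIII, indicator_apply]

theorem densityIII_of_le {x : ℝ} (hR : 1 < R) (hx : R ≤ |x|) :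
    densityIII L R x = √((x ^ 2 - R ^ 2) * (x ^ 2 - L ^ 2)) / (x ^ 2 - 1) - 1 := by
  have : 0 < x ^ 2 - 1 := by rw [← sq_abs]; nlinarith
  rw [densityIII, indicator_of_mem (by exact Or.inr hx), abs_of_pos this]; ring

theorem densityIII_of_abs_le {x : ℝ} (hL : 0 ≤ L) (hL1 : L < 1) (hx : |x| ≤ L) :
    densityIII L R x = √((R ^ 2 - x ^ 2) * (L ^ 2 - x ^ 2)) / (1 - x ^ 2) - 1 := by
  have : x ^ 2 - 1 < 0 := by rw [← sq_abs]; nlinarith [abs_nonneg x]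
  rw [densityIII, indicator_of_mem (by exact Or.inl hx), abs_of_neg this, neg_sub,
    ← neg_mul_neg, neg_sub, neg_sub]; ring

theorem densityIII_of_gap {x : ℝ} (h1 : L < |x|) (h2 : |x| < R) : densityIII L R x = -1 := by
  rw [densityIII, indicator_of_notMem, add_zero]
  rintro (h | h)
  · exact h1.not_ge h
  · exact h2.not_ge h

theorem densityIII_asymptotic (hL : 0 ≤ L) (hL1 : L < 1) (hR : 1 < R) :
    ∃ C, ∀ y, |densityIII L R y + ((R ^ 2 + L ^ 2) / 2 - 1) * (1 + y ^ 2)⁻¹| ≤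
      C * (1 + y ^ 2)⁻¹ ^ 2 := by
  set κ := (R ^ 2 + L ^ 2) / 2 - 1 with hκ
  have hκ' : ((R ^ 2 - 1) - (1 - L ^ 2)) / 2 = κ := by rw [hκ]; ring
  have hL2 : 0 < 1 - L ^ 2 := by nlinarith
  -- This is the minimum of `(y² - 1)/(y² + 1)` over `|y| ≥ R`.
  set η := (R ^ 2 - 1) / (R ^ 2 + 1) with hη
  have hη0 : 0 < η := div_pos (by nlinarith) (by positivity)
  set C1 := 2 * ((R ^ 2 - 1) * (1 - L ^ 2) + κ ^ 2) / η ^ 2 + 2 * |κ| / η with hC1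
  -- `C1` serves `|y| ≥ R`. `C2` serves `|y| < R`, where the left side is merely bounded and the
  -- last factor compensates for `(1 + y²)⁻²`.
  set C2 := (1 + R / (1 - L ^ 2) + |κ|) * (1 + R ^ 2) ^ 2 with hC2
  have hC1n : 0 ≤ C1 := by
    have : 0 ≤ R ^ 2 - 1 := by nlinarith
    positivity
  have hC2n : 0 ≤ C2 := by positivity
  refine ⟨C1 + C2, fun y => ?_⟩
  have hp : 0 < (1 + y ^ 2)⁻¹ := by positivity
  rw [add_mul]
  rcases le_or_gt R |y| with hy | hy
  · have hyR : R ^ 2 ≤ y ^ 2 := by rw [← sq_abs y]; gcongr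
    have hmain := abs_sqrt_div_sub_one_add_le (u := y ^ 2 - 1) (t := 1 + y ^ 2) (A := R ^ 2 - 1)
      (B := 1 - L ^ 2) (N := √((y ^ 2 - R ^ 2) * (y ^ 2 - L ^ 2))) (η := η) (by nlinarith)
      (by linarith) (by nlinarith) hL2.le (Real.sqrt_nonneg _)
      (by rw [Real.sq_sqrt (mul_nonneg (by linarith) (by nlinarith))]; ring) (by positivity)
      (by rw [abs_le]; constructor <;> linarith) hη0
      (by rw [hη, div_mul_eq_mul_div, div_le_iff₀ (by positivity)]; nlinarith)
    rw [hκ'] at hmain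
    rw [densityIII_of_le hR hy]
    refine hmain.trans (le_add_of_nonneg_right (by positivity))
  · have h1 : |densityIII L R y| ≤ 1 + R / (1 - L ^ 2) := by
      have hR0 : 0 ≤ R / (1 - L ^ 2) := by positivity
      rcases le_or_gt |y| L with h | h
      · have hyL : y ^ 2 ≤ L ^ 2 := by rw [← sq_abs y]; gcongr
        rw [densityIII_of_abs_le hL hL1 h]
        refine (abs_sub _ _).trans ?_
        rw [abs_one, add_comm, abs_of_nonneg (div_nonneg (Real.sqrt_nonneg _) (by linarith))]
        gcongr
        rw [Real.sqrt_le_left (by linarith)]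
        nlinarith [sq_nonneg y, mul_nonneg (sq_nonneg y) (sub_nonneg.2 hyL)]
      · rw [densityIII_of_gap h hy]; simp; exact hR0
    have hyR : y ^ 2 ≤ R ^ 2 := by rw [← sq_abs y]; gcongr
    have h2 : (1 + y ^ 2)⁻¹ ≤ 1 := inv_le_one_of_one_le₀ (by nlinarith)
    have h3 : |densityIII L R y + κ * (1 + y ^ 2)⁻¹| ≤ 1 + R / (1 - L ^ 2) + |κ| := by
      refine (abs_add_le _ _).trans (add_le_add h1 ?_)
      rw [abs_mul, abs_of_pos hp]
      exact mul_le_of_le_one_right (abs_nonneg _) h2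
    have h4 : 1 ≤ (1 + R ^ 2) ^ 2 * (1 + y ^ 2)⁻¹ ^ 2 := by
      rw [← mul_pow]
      refine one_le_pow₀ ?_
      rw [← div_eq_mul_inv, one_le_div (by positivity)]
      linarith
    refine h3.trans ?_
    have : 1 + R / (1 - L ^ 2) + |κ| ≤ C2 * (1 + y ^ 2)⁻¹ ^ 2 := by
      rw [hC2, mul_assoc]
      exact le_mul_of_one_le_right (by positivity) h4
    refine this.trans (le_add_of_nonneg_left (by positivity))

theorem integrable_densityIII (hL : 0 ≤ L) (hL1 : L < 1) (hR : 1 < R) :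
    Integrable (densityIII L R) := by
  obtain ⟨C, hC⟩ := densityIII_asymptotic hL hL1 hR
  exact integrable_of_asymptotic measurable_densityIII hC

theorem neutralDensity_densityIII (hL : 0 ≤ L) (hL1 : L < 1) (hR : 1 < R) :
    NeutralDensity (densityIII L R) (massIII L R) ((R ^ 2 + L ^ 2) / 2 - 1) := by
  obtain ⟨C, hC⟩ := densityIII_asymptotic hL hL1 hR
  refine .of_asymptotic measurable_densityIII densityIII_neg hC ?_
  rw [integral_densityIII hL hL1 hR (integrable_densityIII hL hL1 hR), massIII, gammaIII]
  ring

end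

/-! ### Type I -/

theorem measurable_densityI : Measurable densityI := by
  unfold densityI
  exact measurable_const.add (Measurable.indicator (by fun_prop)
    (measurableSet_le (by fun_prop) (by fun_prop)))

theorem densityI_neg (x : ℝ) : densityI (-x) = densityI x := by
  simp [densityI, indicator_apply]

theorem densityI_of_le {x : ℝ} (hx : Real.pi⁻¹ ≤ |x|) :
    densityI x = √(x ^ 2 - (Real.pi⁻¹) ^ 2) / |x| - 1 := by
  rw [densityI, indicator_of_mem (by exact hx)]; ring

theorem densityI_of_lt {x : ℝ} (hx : |x| < Real.pi⁻¹) : densityI x = -1 := by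
  rw [densityI, indicator_of_notMem (by exact hx.not_ge), add_zero]

theorem densityI_asymptotic :
    ∃ C, ∀ y, |densityI y + (Real.pi⁻¹) ^ 2 / 2 * (1 + y ^ 2)⁻¹| ≤ C * (1 + y ^ 2)⁻¹ ^ 2 := by
  have d1 := @densityI_of_le
  have d2 := @densityI_of_lt
  have ha0 : 0 < Real.pi⁻¹ := by positivity
  generalize Real.pi⁻¹ = a at d1 d2 ha0 ⊢
  have hκ' : (a ^ 2 - 0) / 2 = a ^ 2 / 2 := by ring
  set η := a ^ 2 / (1 + a ^ 2) with hη
  have hη0 : 0 < η := by positivity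
  set C1 := 2 * (a ^ 2 * 0 + (a ^ 2 / 2) ^ 2) / η ^ 2 + 2 * |a ^ 2 / 2| / η with hC1
  set C2 := (1 + a ^ 2 / 2) * (1 + a ^ 2) ^ 2 with hC2
  have hC1n : 0 ≤ C1 := by positivity
  have hC2n : 0 ≤ C2 := by positivity
  refine ⟨C1 + C2, fun y => ?_⟩
  have hp : 0 < (1 + y ^ 2)⁻¹ := by positivity
  rw [add_mul]
  rcases le_or_gt a |y| with hy | hy
  · have hya : a ^ 2 ≤ y ^ 2 := by rw [← sq_abs y]; gcongr
    have hy0 : 0 < |y| := by linarith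
    have hy2 : 0 < y ^ 2 := by rw [← sq_abs]; positivity
    have hmain := abs_sqrt_div_sub_one_add_le (u := y ^ 2) (t := 1 + y ^ 2) (A := a ^ 2)
      (B := 0) (N := √(y ^ 2 - a ^ 2) * |y|) (η := η) hy2 hya (by positivity) le_rfl
      (by positivity) (by rw [mul_pow, Real.sq_sqrt (by linarith), sq_abs]; ring) (by positivity)
      (by norm_num) hη0 (by rw [hη, div_mul_eq_mul_div, div_le_iff₀ (by positivity)]; nlinarith)
    rw [hκ'] at hmain
    have e : densityI y = √(y ^ 2 - a ^ 2) * |y| / y ^ 2 - 1 := by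
      rw [d1 hy]
      congr 1
      rw [← sq_abs y, pow_two |y|, mul_div_mul_right _ _ hy0.ne']
    rw [e]
    refine hmain.trans (le_add_of_nonneg_right (by positivity))
  · have e : densityI y = -1 := d2 hy
    have hya : y ^ 2 ≤ a ^ 2 := by rw [← sq_abs y]; gcongr
    have h2 : (1 + y ^ 2)⁻¹ ≤ 1 := inv_le_one_of_one_le₀ (by nlinarith)
    have h3 : |densityI y + a ^ 2 / 2 * (1 + y ^ 2)⁻¹| ≤ 1 + a ^ 2 / 2 := by
      refine (abs_add_le _ _).trans (add_le_add (by simp [e]) ?_)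
      rw [abs_mul, abs_of_pos hp, abs_of_pos (by positivity)]
      exact mul_le_of_le_one_right (by positivity) h2
    have h4 : 1 ≤ (1 + a ^ 2) ^ 2 * (1 + y ^ 2)⁻¹ ^ 2 := by
      rw [← mul_pow]
      refine one_le_pow₀ ?_
      rw [← div_eq_mul_inv, one_le_div (by positivity)]
      linarith
    refine h3.trans ?_
    have : 1 + a ^ 2 / 2 ≤ C2 * (1 + y ^ 2)⁻¹ ^ 2 := by
      rw [hC2, mul_assoc]
      exact le_mul_of_one_le_right (by positivity) h4
    refine this.trans (le_add_of_nonneg_left (by positivity))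

theorem integrable_densityI : Integrable densityI := by
  obtain ⟨C, hC⟩ := densityI_asymptotic
  exact integrable_of_asymptotic measurable_densityI hC

/-- With `a = π⁻¹`, a primitive beyond `a` is `√(x² - a²) - x - a arctan(√(x² - a²)/a)`. Its value
`-a` at `a` is offset by the integral over `[0, a]`, and its limit at infinity is `-aπ/2 = -1/2`. -/
theorem integral_densityI_Ioi : ∫ x in Ioi 0, densityI x = -1 / 2 := by
  have dens1 := @densityI_of_le
  have dens2 := @densityI_of_lt
  have ha0 : 0 < Real.pi⁻¹ := by positivity
  have hval : (-1 / 2 : ℝ) = 0 - Real.pi⁻¹ * (Real.pi / 2) := by field_simp; ring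
  rw [hval]
  generalize Real.pi⁻¹ = a at dens1 dens2 ha0 ⊢
  have hlim := intervalIntegral_tendsto_integral_Ioi 0 integrable_densityI.integrableOn tendsto_id
  refine tendsto_nhds_unique hlim ?_
  have hint : ∀ p q, IntervalIntegrable densityI volume p q := fun p q =>
    integrable_densityI.intervalIntegrable
  have e : ∀ T : ℝ, a < T → √(T ^ 2 - a ^ 2) - T - a * Real.arctan (√(T ^ 2 - a ^ 2) / a) =
      ∫ x in (0)..id T, densityI x := fun T hT => by
    have e1 : ∫ x in (0)..a, densityI x = -a := by
      have : ∫ x in (0)..a, densityI x = ∫ x in (0)..a, (-1 : ℝ) := by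
        refine intervalIntegral.integral_congr_ae ?_
        filter_upwards [ae_ne_real a] with x hxa hx
        rw [uIoc_of_le ha0.le] at hx
        refine dens2 ?_
        rw [abs_of_pos hx.1]
        exact lt_of_le_of_ne hx.2 hxa
      rw [this]; simp
    have e2 := intervalIntegral.integral_eq_sub_of_hasDerivAt_of_le hT.le
      (f := fun x => √(x ^ 2 - a ^ 2) - x - a * Real.arctan (√(x ^ 2 - a ^ 2) / a))
      (f' := densityI) (by fun_prop) (fun x hx => by
        have hx0 : 0 < x := ha0.trans hx.1
        have hp : 0 < x ^ 2 - a ^ 2 := by nlinarith [hx.1]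
        have hs : 0 < √(x ^ 2 - a ^ 2) := Real.sqrt_pos.2 hp
        have hsq : √(x ^ 2 - a ^ 2) ^ 2 = x ^ 2 - a ^ 2 := Real.sq_sqrt hp.le
        have d0 : HasDerivAt (fun x : ℝ => x ^ 2 - a ^ 2) (2 * x) x := by
          simpa using (hasDerivAt_pow 2 x).sub_const (a ^ 2)
        have d1 := d0.sqrt hp.ne'
        have d2 := (d1.fun_sub (hasDerivAt_id' x)).fun_sub
          (((d1.div_const a).arctan).const_mul a)
        refine d2.congr_deriv ?_
        rw [dens1 (hx.1.le.trans (le_abs_self x)), abs_of_pos hx0,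
          div_pow, hsq]
        have : 1 + (x ^ 2 - a ^ 2) / a ^ 2 = x ^ 2 / a ^ 2 := by field_simp; ring
        rw [this]
        field_simp
        linear_combination -hsq) (hint _ _)
    rw [id, ← intervalIntegral.integral_add_adjacent_intervals (hint 0 a) (hint a T), e1, e2]
    simp
  refine Tendsto.congr' (Filter.eventually_atTop.2 ⟨a + 1, fun T hT => e T (by linarith)⟩) ?_
  have l1 : Tendsto (fun T : ℝ => √(T ^ 2 - a ^ 2) - T) atTop (𝓝 0) := by
    refine squeeze_zero_norm' (a := fun T => a ^ 2 / T) ?_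
      (tendsto_const_nhds.div_atTop tendsto_id)
    filter_upwards [eventually_ge_atTop a] with T hT
    have hT0 : 0 < T := by linarith
    have hs := Real.sqrt_nonneg (T ^ 2 - a ^ 2)
    have hsq : √(T ^ 2 - a ^ 2) ^ 2 = T ^ 2 - a ^ 2 := Real.sq_sqrt (by nlinarith)
    have hle : √(T ^ 2 - a ^ 2) ≤ T := Real.sqrt_le_left hT0.le |>.2 (by nlinarith)
    rw [Real.norm_of_nonpos (by linarith), le_div_iff₀ hT0]
    nlinarith
  have l2 : Tendsto (fun T : ℝ => √(T ^ 2 - a ^ 2) / a) atTop atTop := by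
    have : Tendsto (fun T : ℝ => (√(T ^ 2 - a ^ 2) - T + T)) atTop atTop :=
      l1.add_atTop tendsto_id
    simp only [sub_add_cancel] at this
    exact this.atTop_div_const ha0
  have l3 := ((Real.tendsto_arctan_atTop.mono_right nhdsWithin_le_nhds).comp l2).const_mul a
  exact l1.sub l3

theorem integral_densityI : ∫ x, densityI x = -2 * (1 / 2) := by
  have : ∀ x, densityI x = densityI |x| := fun x => by
    rcases abs_cases x with ⟨h, -⟩ | ⟨h, -⟩ <;> rw [h]
    rw [densityI_neg]
  rw [funext this, integral_comp_abs, integral_densityI_Ioi]; ring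

theorem neutralDensity_densityI : NeutralDensity densityI (1 / 2) ((Real.pi⁻¹) ^ 2 / 2) := by
  obtain ⟨C, hC⟩ := densityI_asymptotic
  exact .of_asymptotic measurable_densityI densityI_neg hC integral_densityI

/-! ### Semicircle integrals and the principal value defining `L(R)` -/

theorem integral_semicircle {A B : ℝ} (h : B ≤ A) :
    ∫ t in B..A, √((A - t) * (t - B)) = Real.pi * (A - B) ^ 2 / 8 := by
  set ρ := (A - B) / 2 with hρ
  have hρ0 : 0 ≤ ρ := by rw [hρ]; linarith
  have e := intervalIntegral.smul_integral_comp_mul_add (a := -1) (b := 1)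
    (fun t => √((A - t) * (t - B))) ρ ((A + B) / 2)
  have h1 : ρ * -1 + (A + B) / 2 = B := by rw [hρ]; ring
  have h2 : ρ * 1 + (A + B) / 2 = A := by rw [hρ]; ring
  rw [h1, h2] at e
  rw [← e]
  have : ∀ s : ℝ, √((A - (ρ * s + (A + B) / 2)) * (ρ * s + (A + B) / 2 - B)) =
      ρ * √(1 - s ^ 2) := fun s => by
    have : (A - (ρ * s + (A + B) / 2)) * (ρ * s + (A + B) / 2 - B) = ρ ^ 2 * (1 - s ^ 2) := by
      rw [hρ]; ring
    rw [this, Real.sqrt_mul (sq_nonneg _), Real.sqrt_sq hρ0]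
  simp_rw [this]
  rw [intervalIntegral.integral_const_mul, integral_sqrt_one_sub_sq, smul_eq_mul, hρ]
  ring

theorem integral_semicircle_mul_sub (A B : ℝ) :
    ∫ t in B..A, √((A - t) * (t - B)) * (t - (A + B) / 2) = 0 := by
  have e := intervalIntegral.integral_comp_sub_left (a := B) (b := A)
    (fun t => √((A - t) * (t - B)) * (t - (A + B) / 2)) (A + B)
  have h1 : A + B - A = B := by ring
  have h2 : A + B - B = A := by ring
  rw [h1, h2] at e
  have : ∀ t, √((A - (A + B - t)) * (A + B - t - B)) * (A + B - t - (A + B) / 2) =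
      -(√((A - t) * (t - B)) * (t - (A + B) / 2)) := fun t => by
    have : (A - (A + B - t)) * (A + B - t - B) = (A - t) * (t - B) := by ring
    rw [this]; ring
  simp_rw [this] at e
  rw [intervalIntegral.integral_neg] at e
  linarith

/-- An antiderivative of `√((a - u)(u + b)) / u`. -/
noncomputable def semicirclePrim (a b u : ℝ) : ℝ :=
  √((a - u) * (u + b)) + (a - b) / 2 * Real.arcsin ((u - (a - b) / 2) / ((a + b) / 2)) -
    √(a * b) * Real.log (a * b + (a - b) / 2 * u + √(a * b) * √((a - u) * (u + b)))

section

variable {a b : ℝ}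

theorem semicirclePrim_log_arg_pos (ha : 0 < a) (hb : 0 < b) {u : ℝ} (h1 : -b ≤ u) (h2 : u ≤ a) :
    0 < a * b + (a - b) / 2 * u + √(a * b) * √((a - u) * (u + b)) := by
  have : 0 < a * b + (a - b) / 2 * u := by
    have e : (a * b + (a - b) / 2 * u) * 2 = a * (u + b) + b * (a - u) := by ring
    have : 0 < a * (u + b) + b * (a - u) := by
      rcases h1.eq_or_lt with h | h
      · rw [← h]; nlinarith
      · nlinarith [mul_pos ha (by linarith : 0 < u + b), mul_nonneg hb.le (sub_nonneg.2 h2)]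
    linarith
  positivity

/-- The singular part `√(ab) log u` is kept apart, so that `semicirclePrim` itself is continuous
across `u = 0` and principal values can be read off. -/
theorem hasDerivAt_semicirclePrim (ha : 0 < a) (hb : 0 < b) {u : ℝ} (h1 : -b < u) (h2 : u < a)
    (h0 : u ≠ 0) : HasDerivAt (fun u => semicirclePrim a b u + √(a * b) * Real.log u)
      (√((a - u) * (u + b)) / u) u := by
  have hX : 0 < (a - u) * (u + b) := mul_pos (by linarith) (by linarith)
  have hs : 0 < √((a - u) * (u + b)) := Real.sqrt_pos.2 hX
  have hs2 : √((a - u) * (u + b)) ^ 2 = (a - u) * (u + b) := Real.sq_sqrt hX.le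
  have hp2 : √(a * b) ^ 2 = a * b := Real.sq_sqrt (by positivity)
  have hl := semicirclePrim_log_arg_pos ha hb h1.le h2.le
  have hσ : 0 < (a + b) / 2 := by positivity
  have d1 : HasDerivAt (fun u : ℝ => √((a - u) * (u + b)))
      ((a - b - 2 * u) / (2 * √((a - u) * (u + b)))) u := by
    have : HasDerivAt (fun u : ℝ => (a - u) * (u + b)) (a - b - 2 * u) u := by
      have := ((hasDerivAt_id' u).const_sub a).fun_mul ((hasDerivAt_id' u).add_const b)
      exact this.congr_deriv (by ring)
    exact this.sqrt hX.ne'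
  have d2 : HasDerivAt (fun u : ℝ => Real.arcsin ((u - (a - b) / 2) / ((a + b) / 2)))
      (1 / √((a - u) * (u + b))) u := by
    have hlt : -1 < (u - (a - b) / 2) / ((a + b) / 2) := by
      rw [lt_div_iff₀ hσ]; linarith
    have hgt : (u - (a - b) / 2) / ((a + b) / 2) < 1 := by
      rw [div_lt_iff₀ hσ]; linarith
    have := (Real.hasDerivAt_arcsin hlt.ne' hgt.ne).comp u
      (((hasDerivAt_id' u).sub_const ((a - b) / 2)).div_const ((a + b) / 2))
    refine this.congr_deriv ?_
    have e : 1 - ((u - (a - b) / 2) / ((a + b) / 2)) ^ 2 =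
        ((a - u) * (u + b)) / ((a + b) / 2) ^ 2 := by field_simp; ring
    rw [e, Real.sqrt_div hX.le, Real.sqrt_sq hσ.le]
    field_simp
  have d3 : HasDerivAt (fun u : ℝ => a * b + (a - b) / 2 * u + √(a * b) * √((a - u) * (u + b)))
      ((a - b) / 2 + √(a * b) * ((a - b - 2 * u) / (2 * √((a - u) * (u + b))))) u := by
    have := (((hasDerivAt_id' u).const_mul ((a - b) / 2)).const_add (a * b)).fun_add
      (d1.const_mul √(a * b))
    exact this.congr_deriv (by ring)
  have d := ((d1.fun_add (d2.const_mul ((a - b) / 2))).fun_sub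
    ((d3.log hl.ne').const_mul √(a * b))).fun_add ((Real.hasDerivAt_log h0).const_mul √(a * b))
  refine d.congr_deriv ?_
  set s := √((a - u) * (u + b))
  set p := √(a * b)
  have key : ((a - b) / 2 + p * ((a - b - 2 * u) / (2 * s))) /
      (a * b + (a - b) / 2 * u + p * s) = u⁻¹ - p / (u * s) := by
    rw [div_eq_iff hl.ne']
    field_simp
    linear_combination (-2 * p) * hs2 + (2 * s) * hp2
  rw [key]
  field_simp
  linear_combination (-2) * hs2 + 2 * hp2

theorem continuous_semicircle : Continuous fun u : ℝ => √((a - u) * (u + b)) := by fun_prop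

theorem continuousOn_semicirclePrim (ha : 0 < a) (hb : 0 < b) :
    ContinuousOn (semicirclePrim a b) (Icc (-b) a) := by
  unfold semicirclePrim
  refine ContinuousOn.sub (Continuous.continuousOn ?_) ?_
  · exact continuous_semicircle.add (continuous_const.mul
      (Real.continuous_arcsin.comp (by fun_prop)))
  · refine continuousOn_const.mul (ContinuousOn.log (by fun_prop) fun u hu => ?_)
    exact (semicirclePrim_log_arg_pos ha hb hu.1 hu.2).ne'

theorem semicirclePrim_right (ha : 0 < a) (hb : 0 < b) : semicirclePrim a b a + √(a * b) * Real.log a =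
    Real.pi * (a - b) / 4 - √(a * b) * Real.log ((a + b) / 2) := by
  have e1 : (a - (a - b) / 2) / ((a + b) / 2) = 1 := by
    rw [div_eq_one_iff_eq (by positivity)]; ring
  have e2 : a * b + (a - b) / 2 * a = a * ((a + b) / 2) := by ring
  rw [semicirclePrim, e1, e2]
  simp only [sub_self, zero_mul, Real.sqrt_zero, Real.arcsin_one, mul_zero, add_zero]
  rw [Real.log_mul ha.ne' (by positivity)]
  ring

theorem semicirclePrim_left (ha : 0 < a) (hb : 0 < b) :
    semicirclePrim a b (-b) + √(a * b) * Real.log (-b) =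
    -(Real.pi * (a - b) / 4) - √(a * b) * Real.log ((a + b) / 2) := by
  have e1 : (-b - (a - b) / 2) / ((a + b) / 2) = -1 := by
    rw [div_eq_iff (by positivity)]; ring
  have e2 : a * b + (a - b) / 2 * -b = b * ((a + b) / 2) := by ring
  rw [semicirclePrim, e1, e2]
  simp only [neg_add_cancel, mul_zero, Real.sqrt_zero, Real.arcsin_neg, Real.arcsin_one, add_zero,
    Real.log_neg_eq_log]
  rw [Real.log_mul hb.ne' (by positivity)]
  ring

end

section

variable {L R : ℝ}

/-- The numerator `√((R² - x²)(x² - L²))` in the definition of `L(R)`. -/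
noncomputable def gapRoot (L R x : ℝ) : ℝ := √((R ^ 2 - x ^ 2) * (x ^ 2 - L ^ 2))

theorem continuous_gapRoot : Continuous (gapRoot L R) := by unfold gapRoot; fun_prop

theorem integral_gapRoot_mul_div {p q : ℝ} (hL : 0 < L) (hL1 : L < 1) (hR : 1 < R) (hp : L ≤ p)
    (hpq : p ≤ q) (hq : q ≤ R) (h1 : q < 1 ∨ 1 < p) :
    ∫ x in p..q, x * gapRoot L R x / (x ^ 2 - 1) =
      1 / 2 * (semicirclePrim (R ^ 2 - 1) (1 - L ^ 2) (q ^ 2 - 1) + 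
        √((R ^ 2 - 1) * (1 - L ^ 2)) * Real.log (q ^ 2 - 1)) -
      1 / 2 * (semicirclePrim (R ^ 2 - 1) (1 - L ^ 2) (p ^ 2 - 1) + 
        √((R ^ 2 - 1) * (1 - L ^ 2)) * Real.log (p ^ 2 - 1)) := by
  have ha : 0 < R ^ 2 - 1 := by nlinarith
  have hb : 0 < 1 - L ^ 2 := by nlinarith
  have hne : ∀ x ∈ Icc p q, x ^ 2 - 1 ≠ 0 := fun x hx => by
    have : 0 < x := by linarith [hx.1]
    rcases h1 with h | h
    · have : x < 1 := hx.2.trans_lt h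
      nlinarith
    · have : 1 < x := h.trans_le hx.1
      nlinarith
  have hmaps : MapsTo (fun x : ℝ => x ^ 2 - 1) (Icc p q) (Icc (-(1 - L ^ 2)) (R ^ 2 - 1)) :=
    fun x hx => by
      have : 0 < x := by linarith [hx.1]
      constructor <;> nlinarith [hx.1, hx.2]
  refine intervalIntegral.integral_eq_sub_of_hasDerivAt_of_le hpq (f := fun x =>
    1 / 2 * (semicirclePrim (R ^ 2 - 1) (1 - L ^ 2) (x ^ 2 - 1) + 
      √((R ^ 2 - 1) * (1 - L ^ 2)) * Real.log (x ^ 2 - 1))) ?_ ?_ ?_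
  · refine continuousOn_const.mul (ContinuousOn.add ?_ ?_)
    · exact (continuousOn_semicirclePrim ha hb).comp (by fun_prop) hmaps
    · exact continuousOn_const.mul (ContinuousOn.log (by fun_prop) hne)
  · intro x hx
    have hx0 : 0 < x := by linarith [hx.1]
    have hd := hasDerivAt_semicirclePrim ha hb (u := x ^ 2 - 1) (by nlinarith [hx.1])
      (by nlinarith [hx.2]) (hne x ⟨hx.1.le, hx.2.le⟩)
    have d0 : HasDerivAt (fun x : ℝ => x ^ 2 - 1) (2 * x) x := by
      simpa using (hasDerivAt_pow 2 x).sub_const 1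
    have := (hd.comp x d0).const_mul (1 / 2)
    refine this.congr_deriv ?_
    have e : (R ^ 2 - 1 - (x ^ 2 - 1)) * (x ^ 2 - 1 + (1 - L ^ 2)) =
      (R ^ 2 - x ^ 2) * (x ^ 2 - L ^ 2) := by ring
    rw [gapRoot, e]
    ring
  · refine ContinuousOn.intervalIntegrable ?_
    rw [uIcc_of_le hpq]
    exact ContinuousOn.div (by have := @continuous_gapRoot L R; fun_prop) (by fun_prop) hne

/-- The extra factor `x` makes the integral elementary through `u = x² - 1`. The one-sided values at
`u = 0` agree, the `log ε` terms cancel up to `log((2 - ε)/(2 + ε))`, and only the arcsine endpoint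
values remain. -/
theorem hasPrincipalValue_gapRoot (hL : 0 < L) (hL1 : L < 1) (hR : 1 < R) :
    HasPrincipalValue (fun x => x * gapRoot L R x / (x ^ 2 - 1)) L 1 R
      (Real.pi * (R ^ 2 + L ^ 2 - 2) / 4) := by
  have ha : 0 < R ^ 2 - 1 := by nlinarith
  have hb : 0 < 1 - L ^ 2 := by nlinarith
  rw [HasPrincipalValue]
  set P := semicirclePrim (R ^ 2 - 1) (1 - L ^ 2) with hP
  set p := √((R ^ 2 - 1) * (1 - L ^ 2)) with hp
  have hcont : ContinuousAt P 0 := (continuousOn_semicirclePrim ha hb).continuousAt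
    (Icc_mem_nhds (by linarith) ha)
  have hsmall : ∀ᶠ ε : ℝ in 𝓝[>] 0, ε ∈ Ioo 0 (min (1 - L) (R - 1)) :=
    Ioo_mem_nhdsGT (lt_min (by linarith) (by linarith))
  have key : ∀ᶠ ε : ℝ in 𝓝[>] 0, Real.pi * (R ^ 2 + L ^ 2 - 2) / 4 + 1 / 2 *
      (P ((1 - ε) ^ 2 - 1) - P ((1 + ε) ^ 2 - 1) + p * Real.log ((2 - ε) / (2 + ε))) =
      (∫ x in L..(1 - ε), x * gapRoot L R x / (x ^ 2 - 1)) +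
        ∫ x in (1 + ε)..R, x * gapRoot L R x / (x ^ 2 - 1) := by
    filter_upwards [hsmall] with ε hε
    have h1 : ε < 1 - L := hε.2.trans_le (min_le_left _ _)
    have h2 : ε < R - 1 := hε.2.trans_le (min_le_right _ _)
    have h0 : 0 < ε := hε.1
    rw [integral_gapRoot_mul_div hL hL1 hR le_rfl (by linarith) (by linarith)
      (Or.inl (by linarith)), integral_gapRoot_mul_div hL hL1 hR (by linarith) (by linarith) le_rfl
      (Or.inr (by linarith))]
    have e1 := semicirclePrim_right ha hb
    have e2 := semicirclePrim_left ha hb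
    rw [neg_sub] at e2
    have l1 : Real.log ((1 - ε) ^ 2 - 1) = Real.log ε + Real.log (2 - ε) := by
      rw [← Real.log_mul h0.ne' (by linarith), ← Real.log_neg_eq_log]; ring_nf
    have l2 : Real.log ((1 + ε) ^ 2 - 1) = Real.log ε + Real.log (2 + ε) := by
      rw [← Real.log_mul h0.ne' (by linarith)]; ring_nf
    rw [Real.log_div (by linarith) (by linarith), l1, l2, e1, e2]
    ring
  refine Tendsto.congr' key ?_
  have t0 : Tendsto (fun ε : ℝ => ε) (𝓝[>] 0) (𝓝 0) := nhdsWithin_le_nhds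
  have t1 : Tendsto (fun ε : ℝ => P ((1 - ε) ^ 2 - 1)) (𝓝[>] 0) (𝓝 (P 0)) := by
    refine hcont.tendsto.comp ?_
    have : Continuous fun ε : ℝ => (1 - ε) ^ 2 - 1 := by fun_prop
    simpa using (this.tendsto 0).mono_left nhdsWithin_le_nhds
  have t2 : Tendsto (fun ε : ℝ => P ((1 + ε) ^ 2 - 1)) (𝓝[>] 0) (𝓝 (P 0)) := by
    refine hcont.tendsto.comp ?_
    have : Continuous fun ε : ℝ => (1 + ε) ^ 2 - 1 := by fun_prop
    simpa using (this.tendsto 0).mono_left nhdsWithin_le_nhds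
  have t3 : Tendsto (fun ε : ℝ => Real.log ((2 - ε) / (2 + ε))) (𝓝[>] 0) (𝓝 0) := by
    have : Tendsto (fun ε : ℝ => (2 - ε) / (2 + ε)) (𝓝[>] 0) (𝓝 ((2 - 0) / (2 + 0))) :=
      (t0.const_sub 2).div (t0.const_add 2) (by norm_num)
    simpa using this.log (by norm_num)
  have := (((t1.sub t2).add (t3.const_mul p)).const_mul (1 / 2)).const_add
    (Real.pi * (R ^ 2 + L ^ 2 - 2) / 4)
  simpa using this

/-- The defining relation of `L(R)` in terms of a nonsingular integral. -/
theorem IsLOf.integral_eq (hR : 1 < R) (h : IsLOf R L) :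
    ∫ x in L..R, gapRoot L R x / (1 + |x|) = Real.pi * (R ^ 2 + L ^ 2 - 2) / 4 := by
  obtain ⟨hL, hL1, hpv⟩ := h
  have hpv2 := hasPrincipalValue_gapRoot hL hL1 hR
  rw [HasPrincipalValue] at hpv hpv2
  have hk : Continuous fun x => gapRoot L R x / (1 + |x|) :=
    continuous_gapRoot.div (by fun_prop) fun x => by positivity
  have hki : ∀ p q, IntervalIntegrable (fun x => gapRoot L R x / (1 + |x|)) volume p q :=
    fun p q => hk.intervalIntegrable _ _
  have hlim : Tendsto (fun ε : ℝ => (∫ x in L..(1 - ε), gapRoot L R x / (1 + |x|)) +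
      ∫ x in (1 + ε)..R, gapRoot L R x / (1 + |x|)) (𝓝[>] 0)
      (𝓝 (∫ x in L..R, gapRoot L R x / (1 + |x|))) := by
    have c := intervalIntegral.continuous_primitive hki L
    have c1 : Continuous fun ε : ℝ => ∫ x in L..(1 - ε), gapRoot L R x / (1 + |x|) :=
      c.comp (f := fun ε : ℝ => 1 - ε) (by fun_prop)
    have c2 : Continuous fun ε : ℝ => (∫ x in L..R, gapRoot L R x / (1 + |x|)) -
        ∫ x in L..(1 + ε), gapRoot L R x / (1 + |x|) :=
      continuous_const.sub (c.comp (f := fun ε : ℝ => 1 + ε) (by fun_prop))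
    have t : Tendsto (fun ε : ℝ => (∫ x in L..(1 - ε), gapRoot L R x / (1 + |x|)) +
        ((∫ x in L..R, gapRoot L R x / (1 + |x|)) - ∫ x in L..(1 + ε), gapRoot L R x / (1 + |x|)))
        (𝓝[>] 0) (𝓝 ((∫ x in L..(1 - 0), gapRoot L R x / (1 + |x|)) +
        ((∫ x in L..R, gapRoot L R x / (1 + |x|)) -
          ∫ x in L..(1 + 0), gapRoot L R x / (1 + |x|)))) :=
      ((c1.add c2).tendsto 0).mono_left nhdsWithin_le_nhds
    rw [sub_zero, add_zero, add_sub_cancel] at t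
    refine t.congr fun ε => ?_
    rw [intervalIntegral.integral_interval_sub_left (hki _ _) (hki _ _)]
  have hsmall : ∀ᶠ ε : ℝ in 𝓝[>] 0, ε ∈ Ioo 0 (min (1 - L) (R - 1)) :=
    Ioo_mem_nhdsGT (lt_min (by linarith) (by linarith))
  -- This is the decomposition `1/(x² - 1) = x/(x² - 1) - 1/(1 + x)`: the first term has an explicit
  -- principal value and the second is regular.
  have piece : ∀ p q : ℝ, L ≤ p → p ≤ q → (q < 1 ∨ 1 < p) →
      ∫ x in p..q, Real.pi * √(-((x ^ 2 - R ^ 2) * (x ^ 2 - L ^ 2))) / (x ^ 2 - 1) =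
        Real.pi * ((∫ x in p..q, x * gapRoot L R x / (x ^ 2 - 1)) -
          ∫ x in p..q, gapRoot L R x / (1 + |x|)) := fun p q hp hpq h1 => by
    have hne : ∀ x ∈ Icc p q, x - 1 ≠ 0 := fun x hx => by
      rcases h1 with h | h
      · have : x < 1 := hx.2.trans_lt h
        linarith
      · have : 1 < x := h.trans_le hx.1
        linarith
    have hne2 : ∀ x ∈ Icc p q, x ^ 2 - 1 ≠ 0 := fun x hx => by
      have : x ^ 2 - 1 = (x - 1) * (x + 1) := by ring
      rw [this]
      exact mul_ne_zero (hne x hx) (by linarith [hx.1])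
    have hi : IntervalIntegrable (fun x => x * gapRoot L R x / (x ^ 2 - 1)) volume p q := by
      refine ContinuousOn.intervalIntegrable ?_
      rw [uIcc_of_le hpq]
      exact ContinuousOn.div (by have := @continuous_gapRoot L R; fun_prop) (by fun_prop) hne2
    rw [← intervalIntegral.integral_sub hi (hki _ _), ← intervalIntegral.integral_const_mul]
    refine intervalIntegral.integral_congr fun x hx => ?_
    rw [uIcc_of_le hpq] at hx
    have hx0 : 0 < x := by linarith [hx.1]
    have e : -((x ^ 2 - R ^ 2) * (x ^ 2 - L ^ 2)) = (R ^ 2 - x ^ 2) * (x ^ 2 - L ^ 2) := by ring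
    have e3 := hne x hx
    have e4 : x ^ 2 - 1 = (x - 1) * (1 + x) := by ring
    simp only [e, abs_of_pos hx0, gapRoot, e4]
    field_simp
    ring
  have hcomb := (hpv2.sub hlim).const_mul Real.pi
  have heq := tendsto_nhds_unique (hpv.congr' (by
    filter_upwards [hsmall] with ε hε
    have h1 : ε < 1 - L := hε.2.trans_le (min_le_left _ _)
    have h2 : ε < R - 1 := hε.2.trans_le (min_le_right _ _)
    have h0 : 0 < ε := hε.1
    rw [piece L (1 - ε) le_rfl (by linarith) (Or.inl (by linarith)),
      piece (1 + ε) R (by linarith) (by linarith) (Or.inr (by linarith))])) (hcomb.congr fun ε => by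
    ring)
  have := Real.pi_pos
  nlinarith

end

/-! ### Bounds on `Rc` and consequences of the equation for `L(R)` -/

theorem Rc_eq : √(Rc ^ 2 - 1) * Real.log (Rc + √(Rc ^ 2 - 1)) - Rc = 0 :=
  existsUnique_critical_radius.choose_spec.1.2

/-- Beyond `11/5` the argument of the logarithm exceeds `4`, and `0.89 · 1.3 > 1` contradicts the
defining equation. -/
theorem Rc_lt : Rc < 11 / 5 := by
  by_contra! h
  have h1 := Rc_eq
  have hs : 89 / 100 * Rc ≤ √(Rc ^ 2 - 1) := Real.le_sqrt_of_sq_le (by nlinarith)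
  have hl : 13 / 10 ≤ Real.log (Rc + √(Rc ^ 2 - 1)) := by
    have : Real.log (2 ^ 2) ≤ Real.log (Rc + √(Rc ^ 2 - 1)) :=
      Real.log_le_log (by norm_num) (by linarith)
    rw [Real.log_pow] at this
    have := Real.log_two_gt_d9
    push_cast at *
    linarith
  have := mul_le_mul hs hl (by norm_num) (Real.sqrt_nonneg _)
  linarith

/-- Up to `3/2` the argument of the logarithm is below `exp 1`, so the product is at most `√(Rc² -
1) < Rc`. -/
theorem lt_Rc : 3 / 2 < Rc := by
  by_contra! h
  have h1 := Rc_eq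
  have h2 := one_lt_Rc
  have hs : √(Rc ^ 2 - 1) < Rc := by
    rw [Real.sqrt_lt' (by linarith)]; linarith
  have hs2 : √(Rc ^ 2 - 1) ≤ 1.12 := by
    rw [Real.sqrt_le_left (by norm_num)]; nlinarith
  have hs0 : 0 < √(Rc ^ 2 - 1) := Real.sqrt_pos.2 (by nlinarith)
  have hl : Real.log (Rc + √(Rc ^ 2 - 1)) ≤ 1 := by
    rw [Real.log_le_iff_le_exp (by linarith)]
    have := Real.exp_one_gt_d9
    linarith
  nlinarith

section

variable {L R : ℝ}

theorem IsLOf.two_lt (hR : 1 < R) (h : IsLOf R L) : 2 < R ^ 2 + L ^ 2 := by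
  have hJ := h.integral_eq hR
  obtain ⟨hL, hL1, -⟩ := h
  have hpos : 0 < ∫ x in L..R, gapRoot L R x / (1 + |x|) := by
    refine intervalIntegral.intervalIntegral_pos_of_pos_on
      ((continuous_gapRoot.div (by fun_prop) fun x => by positivity).intervalIntegrable _ _)
      (fun x hx => ?_) (by linarith)
    refine div_pos (Real.sqrt_pos.2 (mul_pos ?_ ?_)) (by positivity)
    · nlinarith [hx.1, hx.2]
    · nlinarith [hx.1, hx.2]
  rw [hJ] at hpos
  have := Real.pi_pos
  nlinarith

/-- AM-GM applied to the factors `R + x` and `x + L`. -/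
theorem gapRoot_le {x : ℝ} (hL : 0 ≤ L) (h1 : L ≤ x) (h2 : x ≤ R) :
    gapRoot L R x ≤ √((R - x) * (x - L)) * (x + (R + L) / 2) := by
  have e : (R ^ 2 - x ^ 2) * (x ^ 2 - L ^ 2) = ((R - x) * (x - L)) * ((R + x) * (x + L)) := by ring
  rw [gapRoot, e, Real.sqrt_mul (mul_nonneg (by linarith) (by linarith))]
  gcongr
  rw [Real.sqrt_le_left (by linarith)]
  nlinarith [sq_nonneg (R - L)]

/-- If `RL ≥ 1`, then `m = (R + L)/2 ≥ 1`, so `x + m ≤ m(1 + x)` and the semicircle integral gives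
`2(R² + L² - 2) ≤ m(R - L)²`. But `R² + L² - 2 ≥ (R - L)²`, which would force `m ≥ 2`. -/
theorem IsLOf.mul_lt_one (hR : 1 < R) (hR4 : R < 3) (h : IsLOf R L) : R * L < 1 := by
  by_contra! hRL
  have hJ := h.integral_eq hR
  obtain ⟨hL, hL1, -⟩ := h
  have hLR : L ≤ R := by linarith
  set m := (R + L) / 2 with hm
  have hm1 : 1 ≤ m := by
    rw [hm]; nlinarith [sq_nonneg (R - L)]
  have hle : ∫ x in L..R, gapRoot L R x / (1 + |x|) ≤
      ∫ x in L..R, √((R - x) * (x - L)) * m := by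
    refine intervalIntegral.integral_mono_on hLR
      ((continuous_gapRoot.div (by fun_prop) fun x => by positivity).intervalIntegrable _ _)
      (Continuous.intervalIntegrable (by fun_prop) _ _) fun x hx => ?_
    have hx0 : 0 < x := hL.trans_le hx.1
    rw [abs_of_pos hx0, div_le_iff₀ (by linarith), mul_assoc]
    refine (gapRoot_le hL.le hx.1 hx.2).trans ?_
    gcongr
    nlinarith
  rw [intervalIntegral.integral_mul_const, integral_semicircle hLR, hJ] at hle
  have hd : 2 * (R ^ 2 + L ^ 2 - 2) ≤ m * (R - L) ^ 2 := by
    have := Real.pi_pos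
    by_contra! hc
    nlinarith [mul_lt_mul_of_pos_left hc this]
  have hpos : 0 < (R - L) ^ 2 := by
    have : 0 < R - L := by linarith
    positivity
  have hm2 : m < 2 := by rw [hm]; linarith
  nlinarith

theorem integral_gapRoot_mul {φ : ℝ → ℝ} (hφ : Continuous φ) :
    ∫ x in L..R, gapRoot L R x * (x * φ (x ^ 2)) =
      1 / 2 * ∫ t in (L ^ 2)..(R ^ 2), √((R ^ 2 - t) * (t - L ^ 2)) * φ t := by
  have := intervalIntegral.integral_comp_mul_deriv (a := L) (b := R) (f := fun x : ℝ => x ^ 2)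
    (f' := fun x => 2 * x) (g := fun t => √((R ^ 2 - t) * (t - L ^ 2)) * φ t)
    (fun x _ => by simpa using hasDerivAt_pow 2 x) (by fun_prop) (by fun_prop)
  rw [← this, ← intervalIntegral.integral_const_mul]
  congr 1; ext x
  simp only [Function.comp, gapRoot]; ring

/-- The bound `1/(1 + x) ≥ x(7/8 - 3x²/8)`, tangent at `x = 1`, has the form `x φ(x²)`; after `t =
x²` only the mass and the centre of the semicircle on `[L², R²]` enter. -/
theorem IsLOf.quadratic_le (hR : 1 < R) (h : IsLOf R L) :
    (4 - 3 * ((R ^ 2 + L ^ 2 - 2) / 2)) * ((R ^ 2 - L ^ 2) / 2) ^ 2 ≤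
      16 * ((R ^ 2 + L ^ 2 - 2) / 2) := by
  have hJ := h.integral_eq hR
  obtain ⟨hL, hL1, -⟩ := h
  have hLR : L ≤ R := by linarith
  have hge : ∫ x in L..R, gapRoot L R x * (x * (7 / 8 - 3 / 8 * x ^ 2)) ≤
      ∫ x in L..R, gapRoot L R x / (1 + |x|) := by
    refine intervalIntegral.integral_mono_on hLR
      (Continuous.intervalIntegrable (by have := @continuous_gapRoot L R; fun_prop) _ _)
      ((continuous_gapRoot.div (by fun_prop) fun x => by positivity).intervalIntegrable _ _)
      fun x hx => ?_
    have hx0 : 0 < x := hL.trans_le hx.1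
    rw [abs_of_pos hx0, div_eq_mul_inv]
    refine mul_le_mul_of_nonneg_left ?_ (Real.sqrt_nonneg _)
    rw [inv_eq_one_div (1 + x), le_div_iff₀ (by linarith)]
    nlinarith [mul_nonneg (sq_nonneg (x - 1)) (by positivity : 0 ≤ 3 * x ^ 2 + 9 * x + 8)]
  rw [integral_gapRoot_mul (φ := fun t => 7 / 8 - 3 / 8 * t) (by fun_prop), hJ] at hge
  have e : ∫ t in (L ^ 2)..(R ^ 2), √((R ^ 2 - t) * (t - L ^ 2)) * (7 / 8 - 3 / 8 * t) =
      (7 / 8 - 3 / 8 * ((R ^ 2 + L ^ 2) / 2)) * (Real.pi * (R ^ 2 - L ^ 2) ^ 2 / 8) := by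
    have i1 : IntervalIntegrable (fun t => √((R ^ 2 - t) * (t - L ^ 2))) volume (L ^ 2) (R ^ 2) :=
      Continuous.intervalIntegrable (by fun_prop) _ _
    have i2 : IntervalIntegrable (fun t => √((R ^ 2 - t) * (t - L ^ 2)) *
        (t - (R ^ 2 + L ^ 2) / 2)) volume (L ^ 2) (R ^ 2) :=
      Continuous.intervalIntegrable (by fun_prop) _ _
    rw [← integral_semicircle (by nlinarith : L ^ 2 ≤ R ^ 2),
      ← intervalIntegral.integral_const_mul]
    have z := integral_semicircle_mul_sub (R ^ 2) (L ^ 2)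
    have := intervalIntegral.integral_sub (i1.const_mul (7 / 8 - 3 / 8 * ((R ^ 2 + L ^ 2) / 2)))
      (i2.const_mul (3 / 8))
    rw [intervalIntegral.integral_const_mul (3 / 8 : ℝ), z, mul_zero, sub_zero] at this
    rw [← this]
    congr 1; ext t; ring
  rw [e] at hge
  have := Real.pi_pos
  by_contra! hc
  nlinarith [mul_lt_mul_of_pos_left hc this]

end

/-- The elementary inequality behind the lower bound on the goal functional. -/
theorem quadratic_pos {e p : ℝ} (he : 0 < e) (he2 : e < 2) (hep : e < p)
    (h : (4 - 3 * (e ^ 2 / 2)) * (p ^ 2 + (e ^ 2 / 2) ^ 2) ≤ 16 * (e ^ 2 / 2)) :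
    0 < p ^ 2 - (Real.pi - 1) * p + Real.pi * e - 3 / 2 * e ^ 2 := by
  have hpi1 := Real.pi_gt_d4
  have hpi2 := Real.pi_lt_d4
  -- For `e ≥ 1.08`, `2e > π - 1`, so the quadratic increases in `p` from `p = e`, where it equals
  -- `e - e²/2 > 0`.
  rcases le_or_gt 1.08 e with h1 | h1
  · have a1 : 0 ≤ (p - e) * (p + e - (Real.pi - 1)) :=
      mul_nonneg (by linarith) (by linarith)
    have a2 : 0 < e * (2 - e) := mul_pos he (by linarith)
    nlinarith
  -- In the middle range, minimising over all `p` suffices; what remains is concave in `e` and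
  -- positive at both ends.
  rcases le_or_gt 0.5 e with h2 | h2
  · have a1 := sq_nonneg (p - (Real.pi - 1) / 2)
    have a2 : (Real.pi - 1) ^ 2 ≤ 2.1417 ^ 2 := by gcongr; linarith; linarith
    have a3 : 3.14 * e ≤ Real.pi * e := by gcongr; linarith
    nlinarith [mul_nonneg (sub_nonneg.2 h2) (sub_nonneg.2 h1.le)]
  -- For small `e` the hypothesis `h` forces `p ≲ √2 e`, and `τ` is a slightly larger slope. The
  -- quadratic decreases in `p` up to `τe`, and there it is positive because `π > (π - 1)√2` with
  -- enough room.
  · set τ := 1.415 + 0.15 * e with hτ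
    have hτ1 : τ ≤ 1.49 := by rw [hτ]; linarith
    have hτ0 : 1.415 ≤ τ := by rw [hτ]; linarith
    have hpτ : p ≤ τ * e := by
      by_contra! hc
      have c1 : (τ * e) ^ 2 < p ^ 2 := by
        have : 0 < τ * e := by positivity
        gcongr
      have c2 : 2 ≤ τ ^ 2 * (1 - 0.375 * e ^ 2) := by
        have : τ ^ 2 * (1 - 0.375 * e ^ 2) - 2 = 0.002225 + e * (0.4245 + 0.0225 * e -
          0.375 * e * (2.002225 + 0.4245 * e + 0.0225 * e ^ 2)) := by rw [hτ]; ring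
        have : 0 ≤ 0.4245 + 0.0225 * e - 0.375 * e * (2.002225 + 0.4245 * e + 0.0225 * e ^ 2) := by
          nlinarith [mul_pos he he, mul_pos (mul_pos he he) he]
        nlinarith [mul_nonneg he.le this]
      have c3 : 0 < 1 - 0.375 * e ^ 2 := by nlinarith
      have c4 := mul_lt_mul_of_pos_left c1 c3
      have c5 := mul_le_mul_of_nonneg_left c2 (sq_nonneg e)
      nlinarith [mul_nonneg c3.le (sq_nonneg (e ^ 2))]
    have hτe : τ * e ≤ 0.75 := by nlinarith
    have a1 : 0 ≤ (τ * e - p) * ((Real.pi - 1) - p - τ * e) :=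
      mul_nonneg (by linarith) (by linarith)
    have a2 : 0 < τ ^ 2 * e - (Real.pi - 1) * τ + Real.pi - 3 / 2 * e := by
      have b1 : (Real.pi - 3.1416) * (1 - τ) ≥ 0 :=
        mul_nonneg_of_nonpos_of_nonpos (by linarith) (by linarith)
      have b2 : 0 < τ ^ 2 * e - 2.1416 * τ + 3.1416 - 3 / 2 * e := by
        have : 2 * e ≤ τ ^ 2 * e := by gcongr; nlinarith
        rw [hτ] at this ⊢
        linarith
      nlinarith
    have a3 := mul_pos he a2
    nlinarith

/-! ### The mass of `[-1, 1]` for Types II and III -/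

theorem muI_eq_twoAtomMeasure : muI = twoAtomMeasure densityI (1 / 2) 0 := by
  rw [muI, twoAtomMeasure, neg_zero, ← two_smul ℝ, smul_smul]
  norm_num

theorem muIII_eq_twoAtomMeasure (L R : ℝ) :
    muIII L R = twoAtomMeasure (densityIII L R) (massIII L R) 1 := rfl

/-- For `L = 0` the inner band shrinks to the origin, where the square root vanishes, so the
densities agree at every point. -/
theorem muII_eq_muIII {R : ℝ} (hR : 0 < R) : muII R = muIII 0 R := by
  have hd : densityII R = densityIII 0 R := by
    ext x
    unfold densityII densityIII
    congr 1
    rcases eq_or_ne x 0 with rfl | hx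
    · simp [indicator, hR.not_ge]
    · have hx' : ¬ |x| ≤ 0 := by simpa using hx
      simp [indicator, hx]
  have hm : massII R = massIII 0 R := by simp [massII, massIII]
  rw [muII, muIII, hd, hm]

theorem twoAtomMeasure_Icc {h : ℝ → ℝ} (hh : Integrable h) (m : ℝ) :
    twoAtomMeasure h m 1 (Icc (-1) 1) = (∫ x in Icc (-1) 1, h x) + 2 * m := by
  rw [twoAtomMeasure, _root_.add_apply, withDensityᵥ_apply hh measurableSet_Icc,
    _root_.smul_apply, _root_.add_apply,
    VectorMeasure.dirac_apply_of_mem measurableSet_Icc (by norm_num),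
    VectorMeasure.dirac_apply_of_mem measurableSet_Icc (by norm_num), smul_eq_mul]
  ring

theorem dilate_Icc {lam : ℝ} (hl : 0 < lam) (μ : SignedMeasure ℝ) :
    dilate lam μ (Icc (-lam) lam) = lam * μ (Icc (-1) 1) := by
  have h : (fun y : ℝ => lam * y) ⁻¹' Icc (-lam) lam = Icc (-1) 1 := by
    ext y
    simp only [mem_preimage, mem_Icc]
    constructor <;> rintro ⟨h1, h2⟩ <;> constructor <;> nlinarith
  simp [dilate, VectorMeasure.map_apply _ (measurable_const_mul lam) measurableSet_Icc, h]

theorem muIII_Icc {L R : ℝ} (hL : 0 ≤ L) (hL1 : L < 1) (hR : 1 < R) :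
    muIII L R (Icc (-1) 1) = (∫ x in (-L)..L, √((R ^ 2 - x ^ 2) * (L ^ 2 - x ^ 2)) / (1 - x ^ 2))
      - 2 + Real.pi * √((R ^ 2 - 1) * (1 - L ^ 2)) := by
  have hi := integrable_densityIII hL hL1 hR
  have e1 : ∀ x ∈ Icc (-1 : ℝ) 1, densityIII L R x = (Icc (-L) L).indicator
      (fun x => √((R ^ 2 - x ^ 2) * (L ^ 2 - x ^ 2)) / (1 - x ^ 2)) x - 1 := fun x hx => by
    by_cases hxL : x ∈ Icc (-L) L
    · rw [indicator_of_mem hxL, densityIII_of_abs_le hL hL1 (abs_le.2 hxL)]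
    · rw [indicator_of_notMem hxL, densityIII_of_gap, zero_sub]
      · rw [← not_le, abs_le]; exact hxL
      · exact (abs_le.2 hx).trans_lt hR
  have hc : IntegrableOn (fun x => √((R ^ 2 - x ^ 2) * (L ^ 2 - x ^ 2)) / (1 - x ^ 2))
      (Icc (-L) L) := by
    refine ContinuousOn.integrableOn_Icc (ContinuousOn.div (by fun_prop) (by fun_prop) ?_)
    rintro x ⟨h1, h2⟩
    nlinarith
  rw [muIII_eq_twoAtomMeasure, twoAtomMeasure_Icc hi, setIntegral_congr_fun measurableSet_Icc e1,
    integral_sub ((integrable_indicator_iff measurableSet_Icc).2 hc).integrableOn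
      (integrable_const _), setIntegral_indicator measurableSet_Icc,
    inter_eq_right.2 (Icc_subset_Icc (by linarith) hL1.le), integral_Icc_eq_integral_Ioc,
    ← intervalIntegral.integral_of_le (by linarith), massIII]
  simp
  ring

theorem intervalIntegrable_bulk {L : ℝ} (hL : 0 ≤ L) (hL1 : L < 1) {f : ℝ → ℝ}
    (hf : Continuous f) (n : ℕ) :
    IntervalIntegrable (fun x => f x / (1 - x ^ 2) ^ n) volume (-L) L := by
  refine ContinuousOn.intervalIntegrable (ContinuousOn.div (by fun_prop) (by fun_prop) ?_)
  rw [uIcc_of_le (by linarith)]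
  rintro x ⟨h1, h2⟩
  exact pow_ne_zero _ (by nlinarith)

/-- When `RL ≤ 1` the integrand is bounded by `RL`, its value at the centre. -/
theorem integral_bulk_le {L R : ℝ} (hL : 0 ≤ L) (hL1 : L < 1) (hR : 1 < R) (h : R * L ≤ 1) :
    ∫ x in (-L)..L, √((R ^ 2 - x ^ 2) * (L ^ 2 - x ^ 2)) / (1 - x ^ 2) ≤ 2 * R * L ^ 2 := by
  have hLL : -L ≤ L := by linarith
  have hi := intervalIntegrable_bulk hL hL1
    (f := fun x => √((R ^ 2 - x ^ 2) * (L ^ 2 - x ^ 2))) (by fun_prop) 1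
  simp only [pow_one] at hi
  have := intervalIntegral.integral_mono_on hLL hi
    (intervalIntegrable_const (c := R * L)) fun x hx => ?_
  · refine this.trans (le_of_eq ?_)
    rw [intervalIntegral.integral_const, smul_eq_mul]; ring
  · have hx2 : x ^ 2 ≤ L ^ 2 := by nlinarith [hx.1, hx.2]
    have hx1 : x ^ 2 < 1 := by nlinarith
    rw [div_le_iff₀ (by linarith)]
    refine Real.sqrt_le_iff.2 ⟨by have : 0 ≤ 1 - x ^ 2 := by linarith
                                  positivity, ?_⟩
    have hRL : (R * L) ^ 2 ≤ 1 := pow_le_one₀ (by positivity) h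
    have h1 : x ^ 2 * (1 - (R * L) ^ 2) ≤ 1 * (1 - (R * L) ^ 2) :=
      mul_le_mul_of_nonneg_right hx1.le (by linarith)
    have h2 : 0 ≤ (R ^ 2 - 1) * (1 - L ^ 2) := mul_nonneg (by nlinarith) (by nlinarith)
    have h3 : 0 ≤ x ^ 2 * (R ^ 2 + L ^ 2 - 2 * (R * L) ^ 2 - x ^ 2 * (1 - (R * L) ^ 2)) :=
      mul_nonneg (sq_nonneg _) (by nlinarith)
    nlinarith

theorem le_integral_bulk {L R : ℝ} (hL : 0 ≤ L) (hL1 : L < 1) (h : 2 ≤ R ^ 2 + L ^ 2) :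
    2 * L ^ 3 ≤ ∫ x in (-L)..L, √((R ^ 2 - x ^ 2) * (L ^ 2 - x ^ 2)) / (1 - x ^ 2) := by
  have hLL : -L ≤ L := by linarith
  have hi := intervalIntegrable_bulk hL hL1
    (f := fun x => √((R ^ 2 - x ^ 2) * (L ^ 2 - x ^ 2))) (by fun_prop) 1
  simp only [pow_one] at hi
  set b := 1 - L ^ 2 with hb
  have hb0 : 0 < b := by nlinarith
  -- This minorant has the primitive `x - b² x/(1 - x²)`. With `t = 1 - x²` it comes from `(t + R² -
  -- 1)(t - b) ≥ t² - b² ≥ ((t² - b²)/t)²`.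
  have hj : IntervalIntegrable (fun x => 1 - b ^ 2 * (1 + x ^ 2) / (1 - x ^ 2) ^ 2) volume (-L) L :=
    intervalIntegrable_const.sub
      (intervalIntegrable_bulk hL hL1 (f := fun x => b ^ 2 * (1 + x ^ 2)) (by fun_prop) 2)
  have hF := intervalIntegral.integral_eq_sub_of_hasDerivAt
    (f := fun x => x - b ^ 2 * (x / (1 - x ^ 2))) (a := -L) (b := L)
    (f' := fun x => 1 - b ^ 2 * (1 + x ^ 2) / (1 - x ^ 2) ^ 2) (fun x hx => by
      rw [uIcc_of_le hLL] at hx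
      have hx1 : 1 - x ^ 2 ≠ 0 := by nlinarith [hx.1, hx.2]
      have d0 : HasDerivAt (fun x : ℝ => 1 - x ^ 2) (-(2 * x)) x := by
        simpa using (hasDerivAt_pow 2 x).const_sub 1
      refine ((hasDerivAt_id' x).fun_sub
        (((hasDerivAt_id' x).fun_div d0 hx1).const_mul (b ^ 2))).congr_deriv ?_
      ring) hj
  have hval : L - b ^ 2 * (L / (1 - L ^ 2)) - (-L - b ^ 2 * (-L / (1 - (-L) ^ 2))) = 2 * L ^ 3 := by
    rw [neg_sq, ← hb]
    field_simp
    rw [hb]; ring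
  rw [hval] at hF
  rw [← hF]
  refine intervalIntegral.integral_mono_on hLL hj hi fun x hx => ?_
  have hx2 : x ^ 2 ≤ L ^ 2 := by nlinarith [hx.1, hx.2]
  obtain ⟨t, ht⟩ : ∃ t, t = 1 - x ^ 2 := ⟨_, rfl⟩
  have htb : b ≤ t := by linarith
  have ht0 : 0 < t := by linarith
  rw [← ht]
  have h1 : 1 - b ^ 2 * (1 + x ^ 2) / t ^ 2 ≤ (t ^ 2 - b ^ 2) / t / t := by
    rw [div_div, ← pow_two, sub_div, div_self (by positivity)]
    gcongr
    nlinarith [mul_nonneg (sq_nonneg b) (sq_nonneg x)]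
  refine h1.trans (div_le_div_of_nonneg_right (Real.le_sqrt_of_sq_le ?_) ht0.le)
  have hnn : 0 ≤ t ^ 2 - b ^ 2 := by nlinarith
  have h2 : ((t ^ 2 - b ^ 2) / t) ^ 2 ≤ t ^ 2 - b ^ 2 := by
    rw [div_pow, div_le_iff₀ (by positivity), pow_two (t ^ 2 - b ^ 2)]
    exact mul_le_mul_of_nonneg_left (by nlinarith) hnn
  refine h2.trans ?_
  have e : (R ^ 2 - x ^ 2) * (L ^ 2 - x ^ 2) = (t + (R ^ 2 - 1)) * (t - b) := by
    rw [ht, hb]; ring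
  rw [e]
  nlinarith [mul_nonneg (sub_nonneg.2 htb) (by linarith : 0 ≤ R ^ 2 - 1 - b)]

/-- Since `R² - 1 ≥ 1 - L²` and `π > 3`, the mass is at least `2L³ - 2 + 3(1 - L²) = (1 - L)²(1 +
2L)`. -/
theorem muIII_Icc_pos {L R : ℝ} (hL : 0 ≤ L) (hL1 : L < 1) (hR : 1 < R)
    (h : 2 ≤ R ^ 2 + L ^ 2) : 0 < muIII L R (Icc (-1) 1) := by
  rw [muIII_Icc hL hL1 hR]
  have h1 := le_integral_bulk hL hL1 h
  have h2 : 1 - L ^ 2 ≤ √((R ^ 2 - 1) * (1 - L ^ 2)) := by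
    refine Real.le_sqrt_of_sq_le ?_
    rw [pow_two]
    exact mul_le_mul_of_nonneg_right (by linarith) (by nlinarith)
  have h3 := Real.pi_gt_three
  have h4 : 0 < (1 - L) * (3 * (1 + L) - 2 * (1 + L + L ^ 2)) := mul_pos (by linarith) (by nlinarith)
  have h5 : 3 * (1 - L ^ 2) ≤ Real.pi * √((R ^ 2 - 1) * (1 - L ^ 2)) :=
    mul_le_mul h3.le h2 (by nlinarith) (by linarith)
  nlinarith

/-- Here `p² - e² = 1 - (RL)² > 0`. From `2R ≤ 1 + R²` and `1 - L² ≥ p - e²/2`, the mass is at most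
`(π - 1)p - p² + 3e²/2`, which `quadratic_pos` puts below `πe`. -/
theorem IsLOf.sq_muIII_Icc_lt {L R : ℝ} (hR : 1 < R) (hRc : R < Rc) (h : IsLOf R L) :
    muIII L R (Icc (-1) 1) ^ 2 < Real.pi ^ 2 * (R ^ 2 + L ^ 2 - 2) := by
  have hR2 : R < 11 / 5 := hRc.trans Rc_lt
  have h2 := h.two_lt hR
  have hRL := h.mul_lt_one hR (by linarith)
  have hq := h.quadratic_le hR
  obtain ⟨hL, hL1, -⟩ := h
  have hpos := muIII_Icc_pos hL.le hL1 hR h2.le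
  have hle := integral_bulk_le hL.le hL1 hR hRL.le
  have hb : 0 < 1 - L ^ 2 := by nlinarith
  have ha : 0 < R ^ 2 - 1 := by nlinarith
  obtain ⟨p, hp⟩ : ∃ p, p = √((R ^ 2 - 1) * (1 - L ^ 2)) := ⟨_, rfl⟩
  have hp0 : 0 < p := hp ▸ Real.sqrt_pos.2 (by positivity)
  have hp2 : p ^ 2 = (R ^ 2 - 1) * (1 - L ^ 2) := hp ▸ Real.sq_sqrt (by positivity)
  obtain ⟨e, he⟩ : ∃ e, e = √(R ^ 2 + L ^ 2 - 2) := ⟨_, rfl⟩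
  have he0 : 0 < e := he ▸ Real.sqrt_pos.2 (by linarith)
  have he2 : e ^ 2 = R ^ 2 + L ^ 2 - 2 := he ▸ Real.sq_sqrt (by linarith)
  have he4 : e < 2 := by nlinarith
  have hRL2 : (R * L) ^ 2 < 1 := pow_lt_one₀ (by positivity) hRL (by norm_num)
  have hep : e < p := lt_of_pow_lt_pow_left₀ 2 hp0.le (by nlinarith)
  have hq' : (4 - 3 * (e ^ 2 / 2)) * (p ^ 2 + (e ^ 2 / 2) ^ 2) ≤ 16 * (e ^ 2 / 2) := by
    have : p ^ 2 + (e ^ 2 / 2) ^ 2 = ((R ^ 2 - L ^ 2) / 2) ^ 2 := by rw [hp2, he2]; ring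
    rw [this, he2]; exact hq
  have hquad := quadratic_pos he0 he4 hep hq'
  have hbp : p - e ^ 2 / 2 ≤ 1 - L ^ 2 := by
    have : p ≤ 1 - L ^ 2 + e ^ 2 / 2 := by
      refine le_of_sq_le_sq ?_ (by positivity)
      nlinarith [sq_nonneg (e ^ 2)]
    linarith
  have hRa : 2 * R * L ^ 2 ≤ (2 + (R ^ 2 - 1)) * L ^ 2 :=
    mul_le_mul_of_nonneg_right (by nlinarith [sq_nonneg (R - 1)]) (sq_nonneg _)
  have hlt : muIII L R (Icc (-1) 1) < Real.pi * e := by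
    rw [muIII_Icc hL.le hL1 hR, ← hp]
    nlinarith
  calc _ < (Real.pi * e) ^ 2 := pow_lt_pow_left₀ hlt hpos.le (by norm_num)
    _ = _ := by rw [mul_pow, he2]

/-- With `s = √(R² - 1)` the claim `(πs - 2)² < π²(s² - 1)` amounts to `s > (π² + 4)/(4π) ≈ 1.104`.
-/
theorem sq_muIII_zero_Icc_lt {R : ℝ} (hR : 3 / 2 < R) :
    muIII 0 R (Icc (-1) 1) ^ 2 < Real.pi ^ 2 * (R ^ 2 + 0 ^ 2 - 2) := by
  rw [muIII_Icc le_rfl one_pos (by linarith)]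
  obtain ⟨s, hs⟩ : ∃ s, s = √((R ^ 2 - 1) * (1 - 0 ^ 2)) := ⟨_, rfl⟩
  have hs2 : s ^ 2 = R ^ 2 - 1 := by
    rw [hs, Real.sq_sqrt (by nlinarith)]; ring
  have hs1 : 1.118 < s := by
    rw [hs]; exact Real.lt_sqrt_of_sq_lt (by nlinarith)
  rw [← hs]
  simp only [neg_zero, intervalIntegral.integral_same]
  nlinarith [Real.pi_gt_d2, Real.pi_lt_d2]

/-! ### The goal functional for each type -/

theorem not_isTypeI {μ : SignedMeasure ℝ} {lam : ℝ}
    (h : IsTypeIIWith lam μ ∨ IsTypeIIIWith lam μ) : ¬ IsTypeI μ := by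
  rintro ⟨l, hI⟩
  obtain ⟨hl, m, -, hm⟩ := typeII_or_III_singleton h
  have h0 := hm 0
  rw [typeI_singleton hI, if_neg (by rintro (h | h) <;> linarith)] at h0
  exact hI.1.ne' h0

theorem goalG_of_isTypeIWith {μ : SignedMeasure ℝ} {lam : ℝ} (h : IsTypeIWith lam μ) :
    (∀ x, μ.Integrable (logKernel x)) ∧ Integrable (logPotential μ) ∧ massD μ = lam ∧
      goalG μ = 1 / 2 := by
  have hD : massD μ = lam := by
    rw [massD, if_pos ⟨lam, h⟩, scalingFactor_eq (Or.inl h)]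
  obtain ⟨hl, hμ⟩ := h
  have H := neutralDensity_densityI
  rw [muI_eq_twoAtomMeasure] at hμ
  refine ⟨?_, ?_, hD, ?_⟩
  · rw [hμ]; exact fun x => H.integrable_logKernel_dilate 0 hl x
  · rw [hμ]; exact H.integrable_logPotential_dilate 0 hl
  · rw [goalG, hD, hμ, H.energyH_dilate 0 hl]
    field_simp

theorem lt_goalG_of_muIII {μ : SignedMeasure ℝ} {lam L R : ℝ}
    (h : IsTypeIIWith lam μ ∨ IsTypeIIIWith lam μ) (hμ : μ = dilate lam (muIII L R))
    (hL : 0 ≤ L) (hL1 : L < 1) (hR : 1 < R) (h2 : 2 ≤ R ^ 2 + L ^ 2)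
    (hlt : muIII L R (Icc (-1) 1) ^ 2 < Real.pi ^ 2 * (R ^ 2 + L ^ 2 - 2)) :
    (∀ x, μ.Integrable (logKernel x)) ∧ Integrable (logPotential μ) ∧ 0 < massD μ ∧
      1 / 2 < goalG μ := by
  have hl := (typeII_or_III_singleton h).1
  have H := neutralDensity_densityIII hL hL1 hR
  have hpos := muIII_Icc_pos hL hL1 hR h2
  have hD : massD μ = lam * muIII L R (Icc (-1) 1) := by
    rw [massD, if_neg (not_isTypeI h), scalingFactor_eq (Or.inr h), hμ, dilate_Icc hl]
  have hD0 : 0 < massD μ := by rw [hD]; positivity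
  rw [muIII_eq_twoAtomMeasure] at hμ
  refine ⟨?_, ?_, hD0, ?_⟩
  · rw [hμ]; exact fun x => H.integrable_logKernel_dilate 1 hl x
  · rw [hμ]; exact H.integrable_logPotential_dilate 1 hl
  · rw [goalG, lt_div_iff₀ (by positivity), hD, hμ, H.energyH_dilate 1 hl]
    have : 0 < lam ^ 2 := by positivity
    nlinarith

theorem lt_goalG {μ : SignedMeasure ℝ} {lam : ℝ} (h : IsTypeIIWith lam μ ∨ IsTypeIIIWith lam μ) :
    (∀ x, μ.Integrable (logKernel x)) ∧ Integrable (logPotential μ) ∧ 0 < massD μ ∧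
      1 / 2 < goalG μ := by
  have h' := h
  rcases h' with ⟨-, R, hR, hμ⟩ | ⟨-, R, L, hR, hRc, hLR, hμ⟩
  · have hR' : 3 / 2 < R := lt_Rc.trans_le hR
    rw [muII_eq_muIII (by linarith)] at hμ
    exact lt_goalG_of_muIII h hμ le_rfl one_pos (by linarith) (by nlinarith)
      (sq_muIII_zero_Icc_lt hR')
  · exact lt_goalG_of_muIII h hμ hLR.1.le hLR.2.1 hR (hLR.two_lt hR).le
      (hLR.sq_muIII_Icc_lt hR hRc)

end LogPotential

theorem theorem5p1 (μ : MeasureTheory.SignedMeasure ℝ) (hμ : LogPotential.Admissible μ) :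
    (∀ᵐ x : ℝ, μ.Integrable (LogPotential.logKernel x)) ∧
    MeasureTheory.Integrable (LogPotential.logPotential μ) ∧
    0 < LogPotential.massD μ ∧
    1 / 2 ≤ LogPotential.goalG μ ∧
    (LogPotential.goalG μ = 1 / 2 ↔ LogPotential.IsTypeI μ) := by
  obtain ⟨lam, h | h⟩ := hμ
  · obtain ⟨h1, h2, h3, h4⟩ := LogPotential.goalG_of_isTypeIWith h
    exact ⟨Eventually.of_forall h1, h2, h3 ▸ h.1, h4.ge, fun _ => ⟨lam, h⟩, fun _ => h4⟩
  · obtain ⟨h1, h2, h3, h4⟩ := LogPotential.lt_goalG h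
    exact ⟨Eventually.of_forall h1, h2, h3, h4.le, fun e => absurd e h4.ne',
      fun e => absurd e (LogPotential.not_isTypeI h)⟩
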